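/- Let $n\ge 2$, $0<s<1$, and let $\Omega\subset\mathbb R^n$ be a bounded domain with $C^\infty$ boundary; write $\Omega_e=\mathbb R^n\setminus\overline\Omega$. All functions are real-valued. $H^s(\mathbb R^n)=W^{s,2}(\mathbb R^n)$ is the $L^2$-based Sobolev space, and $\widetilde H^s(\Omega)$ is the closure of $C_c^\infty(\Omega)$ in $H^s(\mathbb R^n)$. With $C_{n,s}=\frac{4^s\,\Gamma(n/2+s)}{\pi^{n/2}|\Gamma(-s)|}$ the normalizing constant of the fractional Laplacian, let $$\nabla^s u(x,y)=\sqrt{\tfrac{C_{n,s}}2}\,\frac{u(x)-u(y)}{|y-x|^{n/2+s+1}}(y-x),\qquad \nabla^s_A u(x,y)=\nabla^s u(x,y)+A(x,y)u(x),$$ and define $(\nabla\cdot)^s$ and $(-\Delta)^s_A$ weakly by $\langle(\nabla\cdot)^sV,v\rangle=\langle V,\nabla^s v\rangle_{L^2(\mathbb R^{2n})}$ and $\langle(-\Delta)^s_Au,v\rangle=\langle\nabla^s_Au,\nabla^s_Av\rangle_{L^2(\mathbb R^{2n})}$ for $u,v\in H^s(\mathbb R^n)$, $V\in L^2(\mathbb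 R^{2n},\mathbb R^n)$. For $A:\mathbb R^n\times\mathbb R^n\to\mathbb R^n$ put $A_s(x,y)=\frac{A(x,y)+A(y,x)}2$ and $A_a=A-A_s$, and for a field $B$ put $B_{\|}(x,y)=\frac{B(x,y)\cdot(x-y)}{|x-y|^2}(x-y)$ if $x\neq y$, $B_{\|}(x,x)=B(x,x)$. Call $A$ admissible if it is compactly supported and Hölder continuous of order $s$ on $\mathbb R^n\times\mathbb R^n$ and $$A_{s\|}\in H^s(\mathbb R^{2n}),\qquad A_{a\|}(x,y)\cdot(y-x)\ge0\ \text{ on }\mathbb R^n\times\mathbb R^n,\qquad (\nabla\cdot)^sA_{s\|}+\int_{\mathbb R^n}|A(x,y)|^2\,dy\ge0\ \text{ in }\Omega,$$ the last inequality in the sense of distributions. For $F\in L^\infty(\Omega)$ and $g\in L^\infty(\Omega_e)$, a weak solution of $$(-\Delta)^s_Au=F\ \text{ in }\Omega,\qquad u=g\ \text{ in }\Omega_e \tag{1}$$ is a function $u\in H^s(\mathbb R^n)$ with $u=g$ a.e. in $\Omega_e$ and $\langle\nabla^s_Au,\nabla^s_A\phi\rangle_{L^2(\mathbb R^{2n})}=\int_\Omega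 F\phi\,dx$ for all $\phi\in\widetilde H^s(\Omega)$. **Proposition.** (i) There is a constant $C>0$, depending only on $n$, $s$ and $\Omega$, such that for every admissible $A$, all $F\in L^\infty(\Omega)$, $g\in L^\infty(\Omega_e)$ and every weak solution $u$ of (1), $$\|u\|_{L^\infty(\mathbb R^n)}\le\|g\|_{L^\infty(\Omega_e)}+C\|F\|_{L^\infty(\Omega)}.\tag{2}$$ (ii) For an admissible $A$, estimate (2) holds, for all such $F,g,u$, with any constant $C$ for which there is a barrier, that is, a function $\varphi\in C_c^\infty(\mathbb R^n)$ with $(-\Delta)^s_A\varphi\ge1$ in $\Omega$ (in the sense of distributions), $\varphi\ge0$ in $\mathbb R^n$ and $\varphi\le C$ in $\Omega$. -/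

import Mathlib

open MeasureTheory Set Function
open scoped ENNReal ContDiff

noncomputable section

namespace FracMagnetic

/-- `ℝⁿ` with its Euclidean norm. -/
abbrev Rn (n : ℕ) : Type := EuclideanSpace ℝ (Fin n)

/-- `ℝ²ⁿ` with its Euclidean norm; the two blocks of coordinates are indexed by the two copies
of `Fin n`. -/
abbrev R2n (n : ℕ) : Type := EuclideanSpace ℝ (Fin n ⊕ Fin n)

/-! ### Domains -/

/-- A bounded smooth domain: a bounded (nonempty) connected open set which, near each of its
boundary points, is the sublevel set `{ρ < 0}` of a `C^∞` function `ρ` with nonvanishing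
differential at that point. -/
structure IsBoundedSmoothDomain {n : ℕ} (Ω : Set (Rn n)) : Prop where
  isOpen : IsOpen Ω
  isConnected : IsConnected Ω
  isBounded : Bornology.IsBounded Ω
  smooth_boundary : ∀ x ∈ frontier Ω, ∃ (U : Set (Rn n)) (ρ : Rn n → ℝ),
    IsOpen U ∧ x ∈ U ∧ ContDiffOn ℝ ∞ ρ U ∧ fderiv ℝ ρ x ≠ 0 ∧
      ∀ y ∈ U, (y ∈ Ω ↔ ρ y < 0)

/-- The exterior `Ω_e = ℝⁿ \ closure Ω`. -/
def ext {n : ℕ} (Ω : Set (Rn n)) : Set (Rn n) := (closure Ω)ᶜ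

/-! ### Fractional Sobolev spaces `H^s = W^{s,2}`, `0 < s < 1` -/

/-- The squared Gagliardo seminorm
`∬ |f x - f y|² / |x - y|^{d + 2s} dx dy` of a function on a Euclidean space of dimension `d`. -/
def gagliardo {ι W : Type*} [Fintype ι] [NormedAddCommGroup W] (s : ℝ)
    (f : EuclideanSpace ℝ ι → W) : ℝ≥0∞ :=
  ∫⁻ p : EuclideanSpace ℝ ι × EuclideanSpace ℝ ι,
    ENNReal.ofReal (‖f p.1 - f p.2‖ ^ 2 / ‖p.1 - p.2‖ ^ ((Fintype.card ι : ℝ) + 2 * s))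

/-- The squared `H^s`-norm `‖f‖²_{L²} + [f]²_s`. -/
def hsNormSq {ι W : Type*} [Fintype ι] [NormedAddCommGroup W] (s : ℝ)
    (f : EuclideanSpace ℝ ι → W) : ℝ≥0∞ :=
  eLpNorm f 2 volume ^ 2 + gagliardo s f

/-- `f ∈ H^s`: `f ∈ L²` and the Gagliardo seminorm of `f` is finite. -/
def MemHs {ι W : Type*} [Fintype ι] [NormedAddCommGroup W] (s : ℝ)
    (f : EuclideanSpace ℝ ι → W) : Prop :=
  MemLp f 2 volume ∧ gagliardo s f < ⊤

/-- `ψ ∈ C_c^∞(Ω)`, as a function on `ℝⁿ`. -/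
def IsTestFunction {n : ℕ} (Ω : Set (Rn n)) (ψ : Rn n → ℝ) : Prop :=
  ContDiff ℝ ∞ ψ ∧ HasCompactSupport ψ ∧ tsupport ψ ⊆ Ω

/-- `φ ∈ H̃^s(Ω)`, the closure of `C_c^∞(Ω)` in `H^s(ℝⁿ)`. -/
def MemHsTilde {n : ℕ} (s : ℝ) (Ω : Set (Rn n)) (φ : Rn n → ℝ) : Prop :=
  MemHs s φ ∧ ∀ ε : ℝ≥0∞, 0 < ε → ∃ ψ, IsTestFunction Ω ψ ∧ hsNormSq s (φ - ψ) < ε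

/-! ### Fractional gradient, fractional divergence, magnetic fractional Laplacian -/

/-- The normalizing constant `C_{n,s} = 4^s Γ(n/2 + s) / (π^{n/2} |Γ(-s)|)` of the fractional
Laplacian. -/
def fracConst (n : ℕ) (s : ℝ) : ℝ :=
  4 ^ s * Real.Gamma ((n : ℝ) / 2 + s) / (Real.pi ^ ((n : ℝ) / 2) * |Real.Gamma (-s)|)

/-- The fractional gradient
`∇^s u (x, y) = √(C_{n,s} / 2) (u x - u y) / |y - x|^{n/2 + s + 1} (y - x)`. -/
def fracGrad {n : ℕ} (s : ℝ) (u : Rn n → ℝ) (x y : Rn n) : Rn n :=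
  (Real.sqrt (fracConst n s / 2) * ((u x - u y) / ‖y - x‖ ^ ((n : ℝ) / 2 + s + 1))) • (y - x)

/-- The fractional divergence: the pairing `⟨(∇·)^s V, v⟩ = ⟨V, ∇^s v⟩_{L²(ℝ²ⁿ)}`. -/
def fracDiv {n : ℕ} (s : ℝ) (V : Rn n → Rn n → Rn n) (v : Rn n → ℝ) : ℝ :=
  ∫ p : Rn n × Rn n, inner ℝ (V p.1 p.2) (fracGrad s v p.1 p.2)

/-- The magnetic fractional gradient `∇^s_A u (x, y) = ∇^s u (x, y) + A(x, y) u x`. -/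
def magGrad {n : ℕ} (s : ℝ) (A : Rn n → Rn n → Rn n) (u : Rn n → ℝ) (x y : Rn n) : Rn n :=
  fracGrad s u x y + u x • A x y

/-- The magnetic fractional Laplacian in weak form: the pairing
`⟨(-Δ)^s_A u, v⟩ = ⟨∇^s_A u, ∇^s_A v⟩_{L²(ℝ²ⁿ)}`. -/
def magForm {n : ℕ} (s : ℝ) (A : Rn n → Rn n → Rn n) (u v : Rn n → ℝ) : ℝ :=
  ∫ p : Rn n × Rn n, inner ℝ (magGrad s A u p.1 p.2) (magGrad s A v p.1 p.2)

/-! ### The magnetic potential -/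

/-- The symmetric part of `A`. -/
def symPart {n : ℕ} (A : Rn n → Rn n → Rn n) (x y : Rn n) : Rn n :=
  (1 / 2 : ℝ) • (A x y + A y x)

/-- The antisymmetric part of `A`. -/
def antiPart {n : ℕ} (A : Rn n → Rn n → Rn n) (x y : Rn n) : Rn n :=
  A x y - symPart A x y

open Classical in
/-- The parallel part of `A`. -/
def parPart {n : ℕ} (A : Rn n → Rn n → Rn n) (x y : Rn n) : Rn n :=
  if x = y then A x y else (inner ℝ (A x y) (x - y) / ‖x - y‖ ^ 2) • (x - y)

/-- A field on `ℝⁿ × ℝⁿ` regarded as a function on the Euclidean space `ℝ²ⁿ`. -/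
def onR2n {n : ℕ} (V : Rn n → Rn n → Rn n) (z : R2n n) : Rn n :=
  V (WithLp.toLp 2 fun i => z (Sum.inl i)) (WithLp.toLp 2 fun i => z (Sum.inr i))

/-- The assumptions on the magnetic potential: `A ∈ C^s_c(ℝⁿ × ℝⁿ, ℝⁿ)` (compactly supported and
Hölder continuous of order `s`), `A_{s∥} ∈ H^s(ℝ²ⁿ)`, `A_{a∥}(x, y) · (y - x) ≥ 0` everywhere, and
`(∇·)^s A_{s∥} + ∫ |A(·, y)|² dy ≥ 0` in `Ω` in the sense of distributions. -/
structure IsAdmissible {n : ℕ} (s : ℝ) (Ω : Set (Rn n)) (A : Rn n → Rn n → Rn n) : Prop where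
  holder : ∃ K, HolderWith K s.toNNReal (uncurry A)
  compact_support : HasCompactSupport (uncurry A)
  symPar_memHs : MemHs s (onR2n (parPart (symPart A)))
  antiPar_nonneg : ∀ x y, 0 ≤ inner ℝ (parPart (antiPart A) x y) (y - x)
  potential_nonneg : ∀ ψ, IsTestFunction Ω ψ → (∀ x, 0 ≤ ψ x) →
    0 ≤ fracDiv s (parPart (symPart A)) ψ + ∫ x, (∫ y, ‖A x y‖ ^ 2) * ψ x

/-! ### Weak solutions and barriers -/

/-- `u ∈ H^s(ℝⁿ)` is a weak solution of `(-Δ)^s_A u = F` in `Ω`, `u = g` in `Ω_e`. -/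
structure IsWeakSolution {n : ℕ} (s : ℝ) (Ω : Set (Rn n)) (A : Rn n → Rn n → Rn n)
    (F g u : Rn n → ℝ) : Prop where
  memHs : MemHs s u
  eq_in : ∀ φ, MemHsTilde s Ω φ → magForm s A u φ = ∫ x in Ω, F x * φ x
  eq_ext : u =ᵐ[volume.restrict (ext Ω)] g

/-- `φ` is a barrier with bound `C`: `φ ∈ C_c^∞(ℝⁿ)`, `(-Δ)^s_A φ ≥ 1` in `Ω` (in the sense of
distributions), `φ ≥ 0` in `ℝⁿ` and `φ ≤ C` in `Ω`. -/
structure IsBarrier {n : ℕ} (s : ℝ) (Ω : Set (Rn n)) (A : Rn n → Rn n → Rn n) (C : ℝ)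
    (φ : Rn n → ℝ) : Prop where
  smooth : ContDiff ℝ ∞ φ
  compact_support : HasCompactSupport φ
  one_le : ∀ ψ, IsTestFunction Ω ψ → (∀ x, 0 ≤ ψ x) → ∫ x, ψ x ≤ magForm s A φ ψ
  nonneg : ∀ x, 0 ≤ φ x
  le_bound : ∀ x ∈ Ω, φ x ≤ C

end FracMagnetic

end

/-! Expanding `inner (magGrad u) (magGrad v)` and symmetrizing in `(x, y)` splits the magnetic form
into three parts: the Gagliardo form with weight `C_{n,s}/2`, a jump form `∬ β(x,y) (u x - u y)(v x
- v y)`, and a zero-order term `∫ q u v`. The kernel `β` (`symKernel`) sees only `A_{a∥}`, and `q`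
(`potential`) is `(∇·)^s A_{s∥} + ∫ |A(·,y)|² dy`. Admissibility says precisely that `β ≥ 0`
everywhere and `q ≥ 0` in `Ω`, so the form obeys a weak maximum principle. The reduction is
`IsAdmissible.magForm_eq`.

Given a barrier `φ`, put `w = u - Nφ` with `N = ‖F‖_∞`, `M = ‖g‖_∞`, and test with `f = (w - M)₊`.
The barrier inequality makes the form of `(w, f)` nonpositive, while each of the three parts is
nonnegative and the first dominates `[f]_s²`. Hence `f` has zero seminorm and vanishes outside `Ω`,
so `f = 0` and `u ≤ M + Nφ`; the lower bound is the same for `-u`. This is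
`IsWeakSolution.le_barrier`.

Two points need care. First, `f` must be admissible both in the equation and in the barrier
inequality, which is assumed only for nonnegative test functions. So `f` is approximated in `H^s` by
nonnegative elements of `C_c^∞(Ω)`: the smooth boundary allows local inward translations, followed
by mollification (`IsBoundedSmoothDomain.isNonnegTestLimit`). Second, the constant in (i) must not
depend on `A`. A multiple of a cutoff equal to `1` on `Ω` is a barrier for all admissible `A` at
once: against a nonnegative test function the `β` and `q` terms are nonnegative and can be dropped,
leaving a bound for the fractional Laplacian alone (`IsBoundedSmoothDomain.exists_barrier`). -/

noncomputable section

namespace FracMagnetic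

section

variable {n : ℕ}

/-! ### Kernels dominated by an integrable convolution kernel -/

/-- A kernel `c(x, y)` bounded by `h(x - y)` with `h` integrable. -/
def IsDominatedKernel (c : Rn n × Rn n → ℝ) : Prop :=
  AEStronglyMeasurable c volume ∧ ∃ h : Rn n → ℝ, Integrable h ∧ ∀ p, |c p| ≤ h (p.1 - p.2)

lemma IsDominatedKernel.swap {c : Rn n × Rn n → ℝ} (hc : IsDominatedKernel c) :
    IsDominatedKernel (fun p => c p.swap) := by
  obtain ⟨hm, h, hi, hb⟩ := hc
  refine ⟨hm.prod_swap, fun z => h (-z), hi.comp_neg, fun p => ?_⟩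
  simpa using hb p.swap

lemma IsDominatedKernel.add {c d : Rn n × Rn n → ℝ} (hc : IsDominatedKernel c)
    (hd : IsDominatedKernel d) : IsDominatedKernel (fun p => c p + d p) := by
  obtain ⟨hm, h, hi, hb⟩ := hc
  obtain ⟨hm', h', hi', hb'⟩ := hd
  exact ⟨hm.add hm', fun z => h z + h' z, hi.add hi', fun p =>
    (abs_add_le _ _).trans (add_le_add (hb p) (hb' p))⟩

lemma IsDominatedKernel.const_mul {c : Rn n × Rn n → ℝ} (hc : IsDominatedKernel c) (t : ℝ) :
    IsDominatedKernel (fun p => t * c p) := by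
  obtain ⟨hm, h, hi, hb⟩ := hc
  refine ⟨hm.const_mul t, fun z => |t| * h z, hi.const_mul _, fun p => ?_⟩
  rw [abs_mul]
  exact mul_le_mul_of_nonneg_left (hb p) (abs_nonneg t)

lemma IsDominatedKernel.sub {c d : Rn n × Rn n → ℝ} (hc : IsDominatedKernel c)
    (hd : IsDominatedKernel d) : IsDominatedKernel (fun p => c p - d p) := by
  simpa [sub_eq_add_neg] using hc.add (hd.const_mul (-1))

/-- The dominating function `h (x - y) f y` is a convolution integrand of two integrable functions.
-/
lemma IsDominatedKernel.integrable_mul_snd {c : Rn n × Rn n → ℝ} (hc : IsDominatedKernel c)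
    {f : Rn n → ℝ} (hf : Integrable f) : Integrable (fun p => c p * f p.2) := by
  obtain ⟨hm, h, hi, hb⟩ := hc
  have key := hf.convolution_integrand (ContinuousLinearMap.mul ℝ ℝ) hi
  refine Integrable.mono key (hm.mul (hf.aestronglyMeasurable.comp_snd)) ?_
  refine Filter.Eventually.of_forall fun p => ?_
  simp only [norm_mul, ContinuousLinearMap.mul_apply', Real.norm_eq_abs]
  rw [mul_comm]
  exact mul_le_mul_of_nonneg_left ((hb p).trans (le_abs_self _)) (abs_nonneg _)

lemma IsDominatedKernel.integrable_mul_fst {c : Rn n × Rn n → ℝ} (hc : IsDominatedKernel c)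
    {f : Rn n → ℝ} (hf : Integrable f) : Integrable (fun p => c p * f p.1) := by
  exact (hc.swap.integrable_mul_snd hf).swap

lemma IsDominatedKernel.integrable_mul_prod {c : Rn n × Rn n → ℝ} (hc : IsDominatedKernel c)
    {u v : Rn n → ℝ} (hu : MemLp u 2) (hv : MemLp v 2) :
    Integrable (fun p => c p * (u p.1 * v p.2)) := by
  have h1 := (hc.integrable_mul_fst hu.integrable_sq).norm.add
    (hc.integrable_mul_snd hv.integrable_sq).norm
  refine Integrable.mono' h1 (hc.1.mul (hu.1.comp_fst.mul hv.1.comp_snd)) ?_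
  refine Filter.Eventually.of_forall fun p => ?_
  simp only [Pi.add_apply, norm_mul, Real.norm_eq_abs, abs_pow, sq_abs]
  rw [← mul_add]
  refine mul_le_mul_of_nonneg_left ?_ (abs_nonneg _)
  rw [← abs_mul]
  exact abs_le.2 ⟨by nlinarith [sq_nonneg (u p.1 + v p.2)], by nlinarith [sq_nonneg (u p.1 - v p.2)]⟩

/-! ### Integrability of powers of the norm -/

lemma integrableOn_ball_norm_rpow {p r : ℝ} (hn : 1 ≤ n) (hp : p < n) :
    IntegrableOn (fun x : Rn n => ‖x‖ ^ (-p)) (Metric.ball 0 r) := by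
  have : Nontrivial (Rn n) := by
    have : Nonempty (Fin n) := ⟨⟨0, hn⟩⟩
    infer_instance
  rw [integrableOn_fun_norm_addHaar volume (f := fun t : ℝ => t ^ (-p))]
  rcases le_or_gt r 0 with hr | hr
  · simp [hr]
  have h := (intervalIntegral.integrableOn_Ioo_rpow_iff (s := (n : ℝ) - 1 - p) hr).2 (by linarith)
  refine h.congr_fun (fun t ht => ?_) measurableSet_Ioo
  simp only [finrank_euclideanSpace, Fintype.card_fin, smul_eq_mul]
  rw [← Real.rpow_natCast, ← Real.rpow_add ht.1, Nat.cast_sub hn]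
  congr 1
  push_cast
  ring

lemma integrableOn_compl_ball_norm_rpow {p r : ℝ} (hp : n < p) (hr : 0 < r) :
    IntegrableOn (fun x : Rn n => ‖x‖ ^ (-p)) (Metric.ball 0 r)ᶜ := by
  have hp0 : 0 < p := (Nat.cast_nonneg n).trans_lt hp
  have h := (integrable_one_add_norm (μ := (volume : Measure (Rn n))) (r := p)
    (by simpa using hp)).const_mul ((1 / r + 1) ^ p)
  refine Integrable.mono' h.integrableOn (measurable_norm.pow_const _).aestronglyMeasurable ?_
  refine (ae_restrict_iff' Metric.isOpen_ball.measurableSet.compl).2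
    (Filter.Eventually.of_forall fun x hx => ?_)
  have hx' : r ≤ ‖x‖ := by simpa using hx
  have hx0 : 0 < ‖x‖ := hr.trans_le hx'
  rw [Real.norm_of_nonneg (by positivity), Real.rpow_neg hx0.le, Real.rpow_neg (by positivity),
    ← div_eq_mul_inv, le_div_iff₀ (by positivity), inv_mul_le_iff₀ (by positivity),
    ← Real.mul_rpow (by positivity) (by positivity)]
  refine Real.rpow_le_rpow (by positivity) ?_ hp0.le
  have : 1 ≤ ‖x‖ / r := (one_le_div hr).2 hx'
  have : ‖x‖ * (1 / r + 1) = ‖x‖ / r + ‖x‖ := by ring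
  linarith

end

section

variable {n : ℕ}

/-! ### The fractional difference quotient -/

/-- The difference quotient `(u x - u y) / |x - y|^{n/2 + s}`. -/
def hsQuot (s : ℝ) (u : Rn n → ℝ) (p : Rn n × Rn n) : ℝ :=
  (u p.1 - u p.2) / ‖p.1 - p.2‖ ^ ((n : ℝ) / 2 + s)

lemma measurable_hsQuot_weight (r : ℝ) :
    Measurable (fun p : Rn n × Rn n => ‖p.1 - p.2‖ ^ r) :=
  ((measurable_fst.sub measurable_snd).norm).pow_const _

lemma aestronglyMeasurable_hsQuot {s : ℝ} {u : Rn n → ℝ} (hu : AEStronglyMeasurable u) :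
    AEStronglyMeasurable (hsQuot s u) volume := by
  unfold hsQuot
  simp_rw [div_eq_mul_inv]
  exact (hu.comp_fst.sub hu.comp_snd).mul (measurable_hsQuot_weight _).inv.aestronglyMeasurable

lemma hsQuot_add (s : ℝ) (u v : Rn n → ℝ) : hsQuot s (u + v) = hsQuot s u + hsQuot s v := by
  funext p
  simp only [hsQuot, Pi.add_apply]
  ring

lemma hsQuot_sub (s : ℝ) (u v : Rn n → ℝ) : hsQuot s (u - v) = hsQuot s u - hsQuot s v := by
  funext p
  simp only [hsQuot, Pi.sub_apply]
  ring

lemma hsQuot_const_smul (s c : ℝ) (u : Rn n → ℝ) : hsQuot s (c • u) = c • hsQuot s u := by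
  funext p
  simp only [hsQuot, Pi.smul_apply, smul_eq_mul]
  ring

lemma hsQuot_congr_ae {s : ℝ} {u v : Rn n → ℝ} (h : u =ᵐ[volume] v) :
    hsQuot s u =ᵐ[volume] hsQuot s v := by
  have h1 : ∀ᵐ p : Rn n × Rn n, u p.1 = v p.1 := Measure.quasiMeasurePreserving_fst.ae h
  have h2 : ∀ᵐ p : Rn n × Rn n, u p.2 = v p.2 := Measure.quasiMeasurePreserving_snd.ae h
  filter_upwards [h1, h2] with p hp1 hp2
  simp only [hsQuot, hp1, hp2]

lemma eLpNorm_two_sq {X : Type*} [MeasurableSpace X] (μ : Measure X) (f : X → ℝ) :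
    eLpNorm f 2 μ ^ 2 = ∫⁻ x, ENNReal.ofReal (f x ^ 2) ∂μ := by
  have h := eLpNorm_nnreal_pow_eq_lintegral (f := f) (μ := μ) (p := 2) (by norm_num)
  have h2 : eLpNorm f 2 μ ^ 2 = ∫⁻ x, ‖f x‖ₑ ^ 2 ∂μ := by
    simp only [← ENNReal.rpow_two]
    simpa only [ENNReal.coe_ofNat, NNReal.coe_ofNat] using h
  rw [h2]
  refine lintegral_congr fun x => ?_
  rw [← ofReal_norm, ← ENNReal.ofReal_pow (norm_nonneg _), Real.norm_eq_abs, sq_abs]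

lemma gagliardo_eq (s : ℝ) (f : Rn n → ℝ) : gagliardo s f = eLpNorm (hsQuot s f) 2 volume ^ 2 := by
  rw [eLpNorm_two_sq, gagliardo]
  refine lintegral_congr fun p => ?_
  simp only [hsQuot, div_pow, Fintype.card_fin, Real.norm_eq_abs, sq_abs]
  rw [← Real.rpow_natCast (_ ^ _), ← Real.rpow_mul (norm_nonneg _)]
  congr 3
  push_cast
  ring

lemma memHs_iff {s : ℝ} {f : Rn n → ℝ} :
    MemHs s f ↔ MemLp f 2 volume ∧ MemLp (hsQuot s f) 2 volume := by
  refine and_congr_right fun h => ?_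
  rw [gagliardo_eq]
  refine ⟨fun h' => ⟨aestronglyMeasurable_hsQuot h.1, ?_⟩, fun h' => ENNReal.pow_lt_top h'.2⟩
  contrapose! h'
  rw [top_le_iff] at h' ⊢
  simp [h']

lemma hsNormSq_eq (s : ℝ) (f : Rn n → ℝ) :
    hsNormSq s f = eLpNorm f 2 volume ^ 2 + eLpNorm (hsQuot s f) 2 volume ^ 2 := by
  rw [hsNormSq, gagliardo_eq]

/-! ### The magnetic kernel -/

lemma fracConst_pos {s : ℝ} (hs0 : 0 < s) (hs1 : s < 1) : 0 < fracConst n s := by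
  have h1 : 0 < Real.Gamma ((n : ℝ) / 2 + s) := Real.Gamma_pos_of_pos (by positivity)
  have h2 : Real.Gamma (-s) ≠ 0 := Real.Gamma_ne_zero fun m h => by
    rcases Nat.eq_zero_or_pos m with rfl | hm
    · simp at h
      linarith
    · have : (1 : ℝ) ≤ m := by exact_mod_cast hm
      linarith
  have h3 := abs_pos.2 h2
  unfold fracConst
  positivity

/-- The kernel `√(C_{n,s} / 2) A(x, y) · (y - x) / |y - x|^{n/2 + s + 1}`. -/
def magKernel (s : ℝ) (A : Rn n → Rn n → Rn n) (p : Rn n × Rn n) : ℝ :=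
  Real.sqrt (fracConst n s / 2) *
    (inner ℝ (A p.1 p.2) (p.2 - p.1) / ‖p.2 - p.1‖ ^ ((n : ℝ) / 2 + s + 1))

lemma inner_fracGrad_right (s : ℝ) (A : Rn n → Rn n → Rn n) (v : Rn n → ℝ) (p : Rn n × Rn n) :
    inner ℝ (A p.1 p.2) (fracGrad s v p.1 p.2) = magKernel s A p * (v p.1 - v p.2) := by
  simp only [fracGrad, magKernel, inner_smul_right]
  ring

lemma inner_fracGrad_fracGrad {s : ℝ} (hs0 : 0 < s) (hs1 : s < 1) (u v : Rn n → ℝ)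
    (p : Rn n × Rn n) :
    inner ℝ (fracGrad s u p.1 p.2) (fracGrad s v p.1 p.2) =
      fracConst n s / 2 * (hsQuot s u p * hsQuot s v p) := by
  have hC := (fracConst_pos (n := n) hs0 hs1)
  have hk : Real.sqrt (fracConst n s / 2) ^ 2 = fracConst n s / 2 := Real.sq_sqrt (by positivity)
  simp only [fracGrad, hsQuot, inner_smul_right, inner_smul_left, real_inner_self_eq_norm_sq,
    RCLike.conj_to_real]
  rcases eq_or_ne p.1 p.2 with h | h
  · simp [h]
  have hd : 0 < ‖p.2 - p.1‖ := norm_pos_iff.2 (sub_ne_zero.2 h.symm)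
  rw [norm_sub_rev p.1 p.2, Real.rpow_add_one hd.ne']
  have := (Real.rpow_pos_of_pos hd ((n : ℝ) / 2 + s)).ne'
  generalize Real.sqrt (fracConst n s / 2) = κ at hk ⊢
  rw [← hk]
  field_simp

lemma inner_magGrad {s : ℝ} (hs0 : 0 < s) (hs1 : s < 1) (A : Rn n → Rn n → Rn n) (u v : Rn n → ℝ)
    (p : Rn n × Rn n) :
    inner ℝ (magGrad s A u p.1 p.2) (magGrad s A v p.1 p.2) =
      fracConst n s / 2 * (hsQuot s u p * hsQuot s v p) +
      magKernel s A p * (2 * (u p.1 * v p.1) - u p.2 * v p.1 - u p.1 * v p.2) +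
      ‖A p.1 p.2‖ ^ 2 * (u p.1 * v p.1) := by
  simp only [magGrad, inner_add_left, inner_add_right, inner_fracGrad_fracGrad hs0 hs1,
    inner_smul_right, inner_smul_left, inner_fracGrad_right, RCLike.conj_to_real,
    real_inner_self_eq_norm_sq]
  rw [real_inner_comm, inner_fracGrad_right]
  ring

/-- The symmetric part of the magnetic kernel. -/
def symKernel (s : ℝ) (A : Rn n → Rn n → Rn n) (p : Rn n × Rn n) : ℝ :=
  (magKernel s A p + magKernel s A p.swap) / 2

/-- The kernel whose marginal is the electric potential generated by `A`. -/
def potKernel (s : ℝ) (A : Rn n → Rn n → Rn n) (p : Rn n × Rn n) : ℝ :=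
  (magKernel s A p - magKernel s A p.swap) + ‖A p.1 p.2‖ ^ 2

/-- The electric potential `(∇·)^s A_{s∥} + ∫ |A(x, y)|² dy`. -/
def potential (s : ℝ) (A : Rn n → Rn n → Rn n) (x : Rn n) : ℝ :=
  ∫ y, potKernel s A (x, y)

lemma inner_parPart (B : Rn n → Rn n → Rn n) (x y : Rn n) :
    inner ℝ (parPart B x y) (y - x) = inner ℝ (B x y) (y - x) := by
  unfold parPart
  split_ifs with h
  · rfl
  · have hd : ‖x - y‖ ≠ 0 := norm_ne_zero_iff.2 (sub_ne_zero.2 h)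
    rw [← neg_sub x y, inner_neg_right, inner_neg_right, inner_smul_left,
      real_inner_self_eq_norm_sq, RCLike.conj_to_real]
    field_simp

lemma magKernel_parPart (s : ℝ) (B : Rn n → Rn n → Rn n) :
    magKernel s (parPart B) = magKernel s B := by
  funext p
  simp only [magKernel, inner_parPart]

lemma magKernel_symPart (s : ℝ) (A : Rn n → Rn n → Rn n) (p : Rn n × Rn n) :
    magKernel s (symPart A) p = (magKernel s A p - magKernel s A p.swap) / 2 := by
  simp only [magKernel, symPart, inner_smul_left, inner_add_left, RCLike.conj_to_real,
    Prod.fst_swap, Prod.snd_swap]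
  rw [← neg_sub p.2 p.1, inner_neg_right, norm_neg]
  ring

lemma magKernel_antiPart (s : ℝ) (A : Rn n → Rn n → Rn n) (p : Rn n × Rn n) :
    magKernel s (antiPart A) p = symKernel s A p := by
  have h : magKernel s (antiPart A) p = magKernel s A p - magKernel s (symPart A) p := by
    simp only [magKernel, antiPart, inner_sub_left]
    ring
  rw [h, magKernel_symPart, symKernel]
  ring

lemma IsAdmissible.symKernel_nonneg {s : ℝ} {Ω : Set (Rn n)} {A : Rn n → Rn n → Rn n}
    (hA : IsAdmissible s Ω A) (p : Rn n × Rn n) : 0 ≤ symKernel s A p := by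
  rw [← magKernel_antiPart, ← magKernel_parPart]
  exact mul_nonneg (Real.sqrt_nonneg _)
    (div_nonneg (hA.antiPar_nonneg _ _) (Real.rpow_nonneg (norm_nonneg _) _))

lemma IsAdmissible.continuous {s : ℝ} (hs0 : 0 < s) {Ω : Set (Rn n)} {A : Rn n → Rn n → Rn n}
    (hA : IsAdmissible s Ω A) : Continuous (uncurry A) := by
  obtain ⟨K, hK⟩ := hA.holder
  exact hK.continuous (by simpa using hs0)

/-- Compact support in both variables confines `x - y` to a ball, which yields an integrable
convolution majorant once the singular weight is included. -/
lemma IsAdmissible.exists_bound {s : ℝ} (hs0 : 0 < s) {Ω : Set (Rn n)} {A : Rn n → Rn n → Rn n}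
    (hA : IsAdmissible s Ω A) :
    ∃ M R : ℝ, 0 ≤ M ∧ ∀ x y, ‖A x y‖ ≤ (Metric.ball (0 : Rn n) R).indicator (fun _ => M) (x - y) := by
  have hc := hA.continuous hs0
  obtain ⟨M, hM⟩ := hA.compact_support.exists_bound_of_continuous hc
  obtain ⟨r, hr⟩ := hA.compact_support.isCompact.isBounded.subset_ball 0
  refine ⟨M, 2 * r, (norm_nonneg _).trans (hM 0), fun x y => ?_⟩
  by_cases hxy : x - y ∈ Metric.ball (0 : Rn n) (2 * r)
  · rw [indicator_of_mem hxy]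
    exact hM (x, y)
  · rw [indicator_of_notMem hxy, norm_le_zero_iff]
    by_contra h
    have hmem := hr (subset_tsupport _ (show (x, y) ∈ support (uncurry A) from h))
    rw [mem_ball_zero_iff, Prod.norm_def, max_lt_iff] at hmem
    exact hxy (mem_ball_zero_iff.2 ((norm_sub_le _ _).trans_lt (by linarith [hmem.1, hmem.2])))

lemma measurable_magKernel {s : ℝ} {A : Rn n → Rn n → Rn n} (hA : Continuous (uncurry A)) :
    Measurable (magKernel s A) := by
  have h1 : Measurable (fun p : Rn n × Rn n => inner ℝ (A p.1 p.2) (p.2 - p.1)) :=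
    (hA.inner (continuous_snd.sub continuous_fst)).measurable
  have h2 : Measurable (fun p : Rn n × Rn n => ‖p.2 - p.1‖ ^ ((n : ℝ) / 2 + s + 1)) :=
    ((measurable_snd.sub measurable_fst).norm).pow_const _
  exact (h1.div h2).const_mul _

lemma abs_inner_div_rpow_le {M : ℝ} (a z : Rn n) {t : ℝ} (ht : 0 < t) (ha : ‖a‖ ≤ M) :
    |inner ℝ a z / ‖z‖ ^ (t + 1)| ≤ M * ‖z‖ ^ (-t) := by
  rcases eq_or_ne z 0 with rfl | hz
  · simp [Real.zero_rpow (neg_ne_zero.2 ht.ne')]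
  have hd : 0 < ‖z‖ := norm_pos_iff.2 hz
  rw [Real.rpow_add_one hd.ne', abs_div, abs_of_pos (by positivity : 0 < ‖z‖ ^ t * ‖z‖), Real.rpow_neg hd.le,
    ← div_eq_mul_inv, div_le_div_iff₀ (by positivity) (by positivity)]
  have := (abs_real_inner_le_norm a z).trans (mul_le_mul_of_nonneg_right ha hd.le)
  calc _ ≤ (M * ‖z‖) * ‖z‖ ^ t := by gcongr
    _ = _ := by ring

lemma IsAdmissible.isDominatedKernel_magKernel {s : ℝ} (hs0 : 0 < s) (hs1 : s < 1) (hn : 2 ≤ n)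
    {Ω : Set (Rn n)} {A : Rn n → Rn n → Rn n} (hA : IsAdmissible s Ω A) :
    IsDominatedKernel (magKernel s A) := by
  obtain ⟨M, R, hM, hb⟩ := hA.exists_bound hs0
  have hn' : (2 : ℝ) ≤ n := by exact_mod_cast hn
  refine ⟨(measurable_magKernel (hA.continuous hs0)).aestronglyMeasurable,
    fun z => Real.sqrt (fracConst n s / 2) *
      (Metric.ball (0 : Rn n) R).indicator (fun z => M * ‖z‖ ^ (-((n : ℝ) / 2 + s))) z, ?_, ?_⟩
  · refine Integrable.const_mul ((integrable_indicator_iff measurableSet_ball).2 ?_) _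
    -- The singularity is integrable because `n/2 + s < n`, which follows from `s < 1 ≤ n/2`.
    exact (integrableOn_ball_norm_rpow (by omega) (by linarith)).const_mul M
  · intro p
    rw [magKernel, abs_mul, abs_of_nonneg (Real.sqrt_nonneg _)]
    refine mul_le_mul_of_nonneg_left ?_ (Real.sqrt_nonneg _)
    have h := abs_inner_div_rpow_le (A p.1 p.2) (p.2 - p.1) (t := (n : ℝ) / 2 + s) (by positivity)
      (hb p.1 p.2)
    rw [norm_sub_rev p.2 p.1] at h ⊢
    refine h.trans (le_of_eq ?_)
    by_cases hp : p.1 - p.2 ∈ Metric.ball (0 : Rn n) R <;> simp [hp, indicator]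

lemma IsAdmissible.isDominatedKernel_norm_sq {s : ℝ} (hs0 : 0 < s)
    {Ω : Set (Rn n)} {A : Rn n → Rn n → Rn n} (hA : IsAdmissible s Ω A) :
    IsDominatedKernel (fun p => ‖A p.1 p.2‖ ^ 2) := by
  obtain ⟨M, R, hM, hb⟩ := hA.exists_bound hs0
  have hc : Continuous (fun p : Rn n × Rn n => ‖A p.1 p.2‖ ^ 2) := (hA.continuous hs0).norm.pow 2
  refine ⟨hc.aestronglyMeasurable, (Metric.ball (0 : Rn n) R).indicator (fun _ => M ^ 2), ?_, ?_⟩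
  · exact (integrable_indicator_iff measurableSet_ball).2
      (integrableOn_const (measure_ball_lt_top.ne))
  · intro p
    rw [abs_of_nonneg (by positivity)]
    refine (pow_le_pow_left₀ (norm_nonneg _) (hb p.1 p.2) 2).trans (le_of_eq ?_)
    by_cases hp : p.1 - p.2 ∈ Metric.ball (0 : Rn n) R <;> simp [hp, indicator]

lemma IsAdmissible.isDominatedKernel_symKernel {s : ℝ} (hs0 : 0 < s) (hs1 : s < 1) (hn : 2 ≤ n)
    {Ω : Set (Rn n)} {A : Rn n → Rn n → Rn n} (hA : IsAdmissible s Ω A) :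
    IsDominatedKernel (symKernel s A) := by
  have h := hA.isDominatedKernel_magKernel hs0 hs1 hn
  have := (h.add h.swap).const_mul (1 / 2)
  refine (congrArg IsDominatedKernel ?_).mp this
  funext p
  rw [symKernel]
  ring

lemma IsAdmissible.isDominatedKernel_potKernel {s : ℝ} (hs0 : 0 < s) (hs1 : s < 1) (hn : 2 ≤ n)
    {Ω : Set (Rn n)} {A : Rn n → Rn n → Rn n} (hA : IsAdmissible s Ω A) :
    IsDominatedKernel (potKernel s A) := by
  have h := hA.isDominatedKernel_magKernel hs0 hs1 hn
  exact (h.sub h.swap).add (hA.isDominatedKernel_norm_sq hs0)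

end

section

variable {n : ℕ}

/-! ### The quadratic form in terms of a nonnegative jump kernel and a potential -/

/-- Symmetrization device: integrands differing by `W - W ∘ swap` have equal integrals. -/
lemma integral_eq_of_eq_add_sub_swap {f g W : Rn n × Rn n → ℝ} (hg : Integrable g)
    (hW : Integrable W) (h : ∀ p, f p = g p + (W p - W p.swap)) : ∫ p, f p = ∫ p, g p := by
  have hWs : Integrable (fun p : Rn n × Rn n => W p.swap) := hW.swap
  have hsw : ∫ p : Rn n × Rn n, W p.swap = ∫ p, W p := integral_prod_swap W
  simp_rw [h]
  rw [integral_add hg (hW.sub' hWs), integral_sub hW hWs, hsw, sub_self, add_zero]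

lemma IsDominatedKernel.integral_mul_fst {c : Rn n × Rn n → ℝ} (hc : IsDominatedKernel c)
    {f : Rn n → ℝ} (hf : Integrable f) :
    ∫ p, c p * f p.1 = ∫ x, (∫ y, c (x, y)) * f x := by
  have h := integral_prod _ (hc.integrable_mul_fst hf)
  simp only [integral_mul_const] at h
  exact h

variable {s : ℝ} {Ω : Set (Rn n)} {A : Rn n → Rn n → Rn n}

lemma IsDominatedKernel.integrable_mul_diff_mul_diff {c : Rn n × Rn n → ℝ}
    (hc : IsDominatedKernel c) {u v : Rn n → ℝ} (hu : MemLp u 2) (hv : MemLp v 2) :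
    Integrable (fun p => c p * ((u p.1 - u p.2) * (v p.1 - v p.2))) := by
  have huv : Integrable (fun x => u x * v x) := hu.integrable_mul hv
  have h1 := hc.integrable_mul_fst huv
  have h2 := hc.integrable_mul_snd huv
  have h3 := hc.integrable_mul_prod hu hv
  have h4 := hc.integrable_mul_prod hv hu
  refine (((h1.add h2).sub h3).sub h4).congr (Filter.Eventually.of_forall fun p => ?_)
  simp only [Pi.add_apply, Pi.sub_apply]
  ring

/-- The cross terms `u x v y + u y v x` are symmetric, so they see only the symmetric part `β` of
`magKernel`. Completing them to `(u x - u y)(v x - v y)` uses up the symmetric part of the diagonal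
term `2 u x v x`; the antisymmetric part remains and joins `|A|²` in the potential. -/
lemma IsAdmissible.magForm_eq (hs0 : 0 < s) (hs1 : s < 1) (hn : 2 ≤ n) (hA : IsAdmissible s Ω A)
    {u v : Rn n → ℝ} (hu : MemHs s u) (hv : MemHs s v) :
    magForm s A u v = fracConst n s / 2 * (∫ p, hsQuot s u p * hsQuot s v p) +
      (∫ p, symKernel s A p * ((u p.1 - u p.2) * (v p.1 - v p.2))) +
      ∫ x, potential s A x * (u x * v x) := by
  rw [memHs_iff] at hu hv
  have hm := hA.isDominatedKernel_magKernel hs0 hs1 hn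
  have hβ := hA.isDominatedKernel_symKernel hs0 hs1 hn
  have hq := hA.isDominatedKernel_potKernel hs0 hs1 hn
  have huv : Integrable (fun x => u x * v x) := hu.1.integrable_mul hv.1
  have hG : Integrable (fun p => hsQuot s u p * hsQuot s v p) := hu.2.integrable_mul hv.2
  have hB := hβ.integrable_mul_diff_mul_diff hu.1 hv.1
  have hQ := hq.integrable_mul_fst huv
  have hW := (hβ.integrable_mul_fst huv).sub
    (((hm.integrable_mul_prod hu.1 hv.1).add (hm.integrable_mul_prod hv.1 hu.1)).const_mul (1 / 2))
  have hX := hG.const_mul (fracConst n s / 2)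
  have hXB : Integrable (fun p => fracConst n s / 2 * (hsQuot s u p * hsQuot s v p) +
    symKernel s A p * ((u p.1 - u p.2) * (v p.1 - v p.2))) := hX.add hB
  have hpot := hq.integral_mul_fst huv
  unfold potential magForm
  rw [← hpot, ← integral_const_mul, ← integral_add hX hB, ← integral_add hXB hQ]
  refine integral_eq_of_eq_add_sub_swap (hXB.add hQ) hW fun p => ?_
  simp only [inner_magGrad hs0 hs1, Pi.sub_apply, Pi.add_apply, symKernel, potKernel,
    Prod.fst_swap, Prod.snd_swap, Prod.swap_swap]
  ring

/-- The kernel of `A_{s∥}` is antisymmetric, so integrating it against `ψ x - ψ y` gives twice its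
integral against `ψ x`. This identifies `potential` with the distribution in the admissibility
condition. -/
lemma IsAdmissible.fracDiv_add_eq (hs0 : 0 < s) (hs1 : s < 1) (hn : 2 ≤ n)
    (hA : IsAdmissible s Ω A) {ψ : Rn n → ℝ} (hψ : Integrable ψ) :
    fracDiv s (parPart (symPart A)) ψ + ∫ x, (∫ y, ‖A x y‖ ^ 2) * ψ x =
      ∫ x, potential s A x * ψ x := by
  have hm := hA.isDominatedKernel_magKernel hs0 hs1 hn
  have hb := hA.isDominatedKernel_norm_sq hs0
  have hq := hA.isDominatedKernel_potKernel hs0 hs1 hn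
  have hα := (hm.sub hm.swap).const_mul (1 / 2)
  have hW := hα.integrable_mul_fst hψ
  have hi : Integrable (fun p : Rn n × Rn n =>
      inner ℝ (parPart (symPart A) p.1 p.2) (fracGrad s ψ p.1 p.2)) := by
    refine (hW.sub (hα.integrable_mul_snd hψ)).congr (Filter.Eventually.of_forall fun p => ?_)
    simp only [inner_fracGrad_right, magKernel_parPart, magKernel_symPart, Pi.sub_apply]
    ring
  unfold potential fracDiv
  rw [← hb.integral_mul_fst hψ, ← hq.integral_mul_fst hψ,
    ← integral_add hi (hb.integrable_mul_fst hψ)]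
  refine integral_eq_of_eq_add_sub_swap (hq.integrable_mul_fst hψ) hW.neg fun p => ?_
  simp only [inner_fracGrad_right, magKernel_parPart, magKernel_symPart, Pi.neg_apply,
    potKernel, Prod.fst_swap, Prod.swap_swap]
  ring

/-- After the substitution `y = x + z` the singular weight depends on `z` alone, so the integrand is
continuous in `x` for each fixed `z` and dominated convergence applies. -/
lemma IsAdmissible.continuous_potential (hs0 : 0 < s) (hs1 : s < 1) (hn : 2 ≤ n)
    (hA : IsAdmissible s Ω A) : Continuous (potential s A) := by
  have hc := hA.continuous hs0
  have hq := hA.isDominatedKernel_potKernel hs0 hs1 hn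
  obtain ⟨-, h, hi, hb⟩ := hq
  have hmeas : Measurable (potKernel s A) := by
    have h1 := measurable_magKernel (s := s) hc
    exact (h1.sub (h1.comp measurable_swap)).add (hc.norm.pow 2).measurable
  have heq : potential s A = fun x => ∫ z, potKernel s A (x, x + z) := by
    funext x
    exact (integral_add_left_eq_self (fun y => potKernel s A (x, y)) x).symm
  rw [heq]
  refine continuous_of_dominated (bound := fun z => h (-z)) (fun x => ?_) (fun x => ?_)
    hi.comp_neg ?_
  · exact (hmeas.comp (by fun_prop : Measurable fun z : Rn n => (x, x + z))).aestronglyMeasurable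
  · refine Filter.Eventually.of_forall fun z => ?_
    simpa using hb (x, x + z)
  · refine Filter.Eventually.of_forall fun z => ?_
    have hc1 : Continuous (fun x : Rn n => A x (x + z)) :=
      hc.comp (by fun_prop : Continuous fun x : Rn n => (x, x + z))
    have hc2 : Continuous (fun x : Rn n => A (x + z) x) :=
      hc.comp (by fun_prop : Continuous fun x : Rn n => (x + z, x))
    simp only [potKernel, magKernel, Prod.swap_prod_mk, add_sub_cancel_left, sub_add_cancel_left]
    fun_prop

/-- By continuity the distributional sign is a pointwise one: a bump concentrated where the
potential is negative would violate it. -/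
lemma IsAdmissible.potential_nonneg_on (hs0 : 0 < s) (hs1 : s < 1) (hn : 2 ≤ n)
    (hΩ : IsOpen Ω) (hA : IsAdmissible s Ω A) {x₀ : Rn n} (hx : x₀ ∈ Ω) :
    0 ≤ potential s A x₀ := by
  by_contra! hneg
  have hqc := hA.continuous_potential hs0 hs1 hn
  obtain ⟨r, hr, hball⟩ := Metric.isOpen_iff.1 (hΩ.inter (isOpen_Iio.preimage hqc)) x₀ ⟨hx, hneg⟩
  let f : ContDiffBump x₀ := ⟨r / 4, r / 2, by positivity, by linarith⟩
  have hsub : tsupport f ⊆ Metric.ball x₀ r := by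
    rw [f.tsupport_eq]
    exact Metric.closedBall_subset_ball (by simp only [f]; linarith)
  have hint : Integrable (f : Rn n → ℝ) := f.contDiff (n := 0).continuous.integrable_of_hasCompactSupport
    f.hasCompactSupport
  have h := hA.potential_nonneg f ⟨f.contDiff, f.hasCompactSupport, hsub.trans fun x hx => (hball hx).1⟩
    fun x => f.nonneg
  rw [hA.fracDiv_add_eq hs0 hs1 hn hint] at h
  have hle : ∀ x, 0 ≤ -(potential s A x * f x) := fun x => by
    by_cases hx : x ∈ Metric.ball x₀ r
    · have : potential s A x < 0 := (hball hx).2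
      nlinarith [f.nonneg' x]
    · rw [image_eq_zero_of_notMem_tsupport fun h' => hx (hsub h')]
      simp
  have hcont : Continuous (fun x => -(potential s A x * f x)) := (hqc.mul f.continuous).neg
  have hpos := hcont.integral_pos_of_hasCompactSupport_nonneg_nonzero (μ := volume)
    (f.hasCompactSupport.mul_left.neg) hle (x := x₀)
    (by simpa [f.one_of_mem_closedBall (Metric.mem_closedBall_self f.rIn_pos.le)] using hneg.ne)
  rw [integral_neg] at hpos
  linarith

end

section

variable {n : ℕ} {s : ℝ}

/-! ### Closure properties of `H^s` -/

/-- Near the diagonal the Lipschitz bound lowers the singularity to order `n + 2s - 2 < n`; away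
from it boundedness leaves the decay `n + 2s > n`. -/
lemma isDominatedKernel_hsQuot_sq (hs0 : 0 < s) (hs1 : s < 1) (hn : 1 ≤ n) {χ : Rn n → ℝ} {K : NNReal}
    {M : ℝ} (hK : LipschitzWith K χ) (hM : ∀ x, |χ x| ≤ M) :
    IsDominatedKernel (fun p => hsQuot s χ p ^ 2) := by
  refine ⟨(aestronglyMeasurable_hsQuot hK.continuous.aestronglyMeasurable).pow 2, fun z =>
    (Metric.ball (0 : Rn n) 1).indicator (fun z => (K : ℝ) ^ 2 * ‖z‖ ^ (-((n : ℝ) + 2 * s - 2))) z +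
    (Metric.ball (0 : Rn n) 1)ᶜ.indicator
      (fun z => (2 * M) ^ 2 * ‖z‖ ^ (-((n : ℝ) + 2 * s))) z, ?_, fun p => ?_⟩
  · refine Integrable.add ((integrable_indicator_iff measurableSet_ball).2 ?_)
      ((integrable_indicator_iff measurableSet_ball.compl).2 ?_)
    · exact (integrableOn_ball_norm_rpow hn (by linarith)).const_mul _
    · exact (integrableOn_compl_ball_norm_rpow (by linarith) one_pos).const_mul _
  rw [abs_of_nonneg (sq_nonneg _)]
  have hd := hK.dist_le_mul p.1 p.2
  rw [Real.dist_eq, dist_eq_norm] at hd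
  have h2 : |χ p.1 - χ p.2| ≤ 2 * M := (abs_sub _ _).trans (by linarith [hM p.1, hM p.2])
  rcases eq_or_ne p.1 p.2 with h | h
  · simp only [hsQuot, h, sub_self, zero_div, ne_eq, OfNat.ofNat_ne_zero, not_false_eq_true,
      zero_pow]
    exact add_nonneg (indicator_nonneg (fun _ _ => by positivity) _)
      (indicator_nonneg (fun _ _ => by positivity) _)
  have hz : 0 < ‖p.1 - p.2‖ := norm_pos_iff.2 (sub_ne_zero.2 h)
  have hw : hsQuot s χ p ^ 2 = |χ p.1 - χ p.2| ^ 2 * ‖p.1 - p.2‖ ^ (-((n : ℝ) + 2 * s)) := by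
    rw [hsQuot, div_pow, sq_abs, Real.rpow_neg hz.le, ← div_eq_mul_inv,
      ← Real.rpow_natCast (_ ^ _), ← Real.rpow_mul hz.le]
    congr 2
    push_cast
    ring
  beta_reduce
  rw [hw]
  by_cases hb : p.1 - p.2 ∈ Metric.ball (0 : Rn n) 1
  · rw [indicator_of_mem hb, indicator_of_notMem (by simpa using hb), add_zero]
    have hsplit : ‖p.1 - p.2‖ ^ (-((n : ℝ) + 2 * s - 2)) =
        ‖p.1 - p.2‖ ^ 2 * ‖p.1 - p.2‖ ^ (-((n : ℝ) + 2 * s)) := by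
      rw [← Real.rpow_natCast, ← Real.rpow_add hz]
      congr 1
      push_cast
      ring
    rw [hsplit, ← mul_assoc, ← mul_pow]
    gcongr
  · rw [indicator_of_notMem hb, indicator_of_mem (by simpa using hb), zero_add]
    gcongr

lemma memLp_mul_hsQuot (hs0 : 0 < s) (hs1 : s < 1) (hn : 1 ≤ n) {χ f : Rn n → ℝ} {K : NNReal}
    {M : ℝ} (hK : LipschitzWith K χ) (hM : ∀ x, |χ x| ≤ M) (hf : MemLp f 2) :
    MemLp (fun p : Rn n × Rn n => f p.1 * hsQuot s χ p) 2 := by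
  have hm : AEStronglyMeasurable (fun p : Rn n × Rn n => f p.1 * hsQuot s χ p) :=
    hf.1.comp_fst.mul (aestronglyMeasurable_hsQuot hK.continuous.aestronglyMeasurable)
  rw [memLp_two_iff_integrable_sq hm]
  refine ((isDominatedKernel_hsQuot_sq hs0 hs1 hn hK hM).integrable_mul_fst hf.integrable_sq).congr
    (Filter.Eventually.of_forall fun p => ?_)
  simp only
  ring

lemma MemHs.lipschitz_mul (hs0 : 0 < s) (hs1 : s < 1) (hn : 1 ≤ n) {χ f : Rn n → ℝ} {K : NNReal}
    {M : ℝ} (hK : LipschitzWith K χ) (hM : ∀ x, |χ x| ≤ M) (hf : MemHs s f) :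
    MemHs s (fun x => χ x * f x) := by
  rw [memHs_iff] at hf ⊢
  have hχm : AEStronglyMeasurable χ (volume : Measure (Rn n)) := hK.continuous.aestronglyMeasurable
  constructor
  · refine hf.1.of_le_mul (c := M) (hχm.mul hf.1.1) (Filter.Eventually.of_forall fun x => ?_)
    rw [norm_mul]
    exact mul_le_mul_of_nonneg_right (hM x) (norm_nonneg _)
  · have h1 : MemLp (fun p : Rn n × Rn n => χ p.2 * hsQuot s f p) 2 := by
      refine hf.2.of_le_mul (c := M) (hχm.comp_snd.mul hf.2.1) (Filter.Eventually.of_forall fun p => ?_)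
      rw [norm_mul]
      exact mul_le_mul_of_nonneg_right (hM _) (norm_nonneg _)
    -- Discrete Leibniz rule: the quotient of `χ f` is `χ y` times that of `f` plus `f x` times that
    -- of `χ`.
    refine (memLp_congr_ae (Filter.Eventually.of_forall fun p => ?_)).1
      (h1.add (memLp_mul_hsQuot hs0 hs1 hn hK hM hf.1))
    simp only [Pi.add_apply, hsQuot]
    ring

lemma memHs_of_contDiff (hs0 : 0 < s) (hs1 : s < 1) (hn : 1 ≤ n) {ψ : Rn n → ℝ}
    (hψ : ContDiff ℝ ∞ ψ) (hc : HasCompactSupport ψ) : MemHs s ψ := by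
  obtain ⟨K, hK⟩ := hψ.lipschitzWith_of_hasCompactSupport hc (by simp)
  obtain ⟨M, hM⟩ := hc.exists_bound_of_continuous hψ.continuous
  rw [memHs_iff]
  refine ⟨hψ.continuous.memLp_of_hasCompactSupport hc, ?_⟩
  have hk := isDominatedKernel_hsQuot_sq hs0 hs1 hn hK hM
  have hm : AEStronglyMeasurable (hsQuot s ψ) volume :=
    aestronglyMeasurable_hsQuot hψ.continuous.aestronglyMeasurable
  rw [memLp_two_iff_integrable_sq hm]
  have hi : Integrable ((tsupport ψ).indicator fun _ => (1 : ℝ)) :=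
    (integrable_indicator_iff (isClosed_tsupport ψ).measurableSet).2
      (integrableOn_const hc.isCompact.measure_lt_top.ne)
  refine Integrable.mono' ((hk.integrable_mul_fst hi).add (hk.integrable_mul_snd hi)) (hm.pow 2)
    (Filter.Eventually.of_forall fun p => ?_)
  rw [Real.norm_of_nonneg (sq_nonneg _)]
  simp only [Pi.add_apply, ← mul_add]
  by_cases h1 : p.1 ∈ tsupport ψ
  · rw [indicator_of_mem h1]
    exact le_mul_of_one_le_right (sq_nonneg _)
      (le_add_of_nonneg_right (indicator_nonneg (fun _ _ => zero_le_one) _))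
  by_cases h2 : p.2 ∈ tsupport ψ
  · rw [indicator_of_mem h2]
    exact le_mul_of_one_le_right (sq_nonneg _)
      (le_add_of_nonneg_left (indicator_nonneg (fun _ _ => zero_le_one) _))
  · simp [hsQuot, image_eq_zero_of_notMem_tsupport h1, image_eq_zero_of_notMem_tsupport h2]

lemma MemHs.sub {f g : Rn n → ℝ} (hf : MemHs s f) (hg : MemHs s g) : MemHs s (f - g) := by
  rw [memHs_iff] at hf hg ⊢
  rw [hsQuot_sub]
  exact ⟨hf.1.sub hg.1, hf.2.sub hg.2⟩

lemma MemHs.const_smul {f : Rn n → ℝ} (hf : MemHs s f) (c : ℝ) : MemHs s (c • f) := by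
  rw [memHs_iff] at hf ⊢
  rw [hsQuot_const_smul]
  exact ⟨hf.1.const_smul c, hf.2.const_smul c⟩

lemma MemHs.truncate {f : Rn n → ℝ} (hf : MemHs s f) {M : ℝ} (hM : 0 ≤ M) :
    MemHs s (fun x => max (f x - M) 0) := by
  have hm : AEStronglyMeasurable (fun x => max (f x - M) 0) volume :=
    (continuous_id.max continuous_const).comp_aestronglyMeasurable
      (hf.1.1.sub aestronglyMeasurable_const)
  rw [memHs_iff] at hf ⊢
  refine ⟨hf.1.of_le hm (Filter.Eventually.of_forall fun x => ?_),
    hf.2.of_le (aestronglyMeasurable_hsQuot hm) (Filter.Eventually.of_forall fun p => ?_)⟩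
  · rw [Real.norm_of_nonneg (le_max_right _ _), Real.norm_eq_abs]
    exact max_le (by linarith [le_abs_self (f x)]) (abs_nonneg _)
  · simp only [hsQuot, norm_div]
    refine div_le_div_of_nonneg_right ?_ (norm_nonneg _)
    have h := abs_max_sub_max_le_abs (f p.1 - M) (f p.2 - M) 0
    simpa [sub_sub_sub_cancel_right] using h

lemma ennreal_add_sq_le (a b : ℝ≥0∞) : (a + b) ^ 2 ≤ 2 * a ^ 2 + 2 * b ^ 2 := by
  have h := ENNReal.rpow_add_le_mul_rpow_add_rpow a b (p := 2) (by norm_num)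
  norm_num at h
  rwa [mul_add] at h

lemma hsNormSq_add_le {f g : Rn n → ℝ} (hf : AEStronglyMeasurable f) (hg : AEStronglyMeasurable g) :
    hsNormSq s (f + g) ≤ 2 * hsNormSq s f + 2 * hsNormSq s g := by
  simp only [hsNormSq_eq, hsQuot_add]
  have h1 := (pow_le_pow_left₀ zero_le (eLpNorm_add_le hf hg (p := 2) (by norm_num)) 2).trans
    (ennreal_add_sq_le _ _)
  have h2 := (pow_le_pow_left₀ zero_le (eLpNorm_add_le (aestronglyMeasurable_hsQuot (s := s) hf)
    (aestronglyMeasurable_hsQuot (s := s) hg) (p := 2) (by norm_num)) 2).trans (ennreal_add_sq_le _ _)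
  calc _ ≤ _ := add_le_add h1 h2
    _ = _ := by ring

lemma hsNormSq_congr_ae {f g : Rn n → ℝ} (h : f =ᵐ[volume] g) : hsNormSq s f = hsNormSq s g := by
  rw [hsNormSq_eq, hsNormSq_eq, eLpNorm_congr_ae h, eLpNorm_congr_ae (hsQuot_congr_ae h)]

lemma MemHs.congr_ae {f g : Rn n → ℝ} (hf : MemHs s f) (h : f =ᵐ[volume] g) : MemHs s g := by
  rw [memHs_iff] at hf ⊢
  exact ⟨(memLp_congr_ae h).1 hf.1, (memLp_congr_ae (hsQuot_congr_ae h)).1 hf.2⟩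

end

section

variable {n : ℕ} {s : ℝ}

/-! ### Approximation by nonnegative test functions -/

lemma tendsto_eLpNorm_sub_translate {V : Type*} [NormedAddCommGroup V] [MeasurableSpace V]
    [BorelSpace V] [SecondCountableTopology V] {μ : Measure V} [IsLocallyFiniteMeasure μ]
    [μ.InnerRegularCompactLTTop] [μ.IsAddLeftInvariant] {f : V → ℝ}
    (hf : MemLp f 2 μ) :
    Filter.Tendsto (fun z : V => eLpNorm (fun p => f p - f (p - z)) 2 μ) (nhds 0) (nhds 0) := by
  have : Fact ((2 : ℝ≥0∞) ≠ ⊤) := ⟨by norm_num⟩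
  have hF : ∀ z : V, eLpNorm (fun p => f p - f (p - z)) 2 μ =
      edist (hf.toLp f) (DomAddAct.mk (-z) +ᵥ hf.toLp f) := fun z => by
    rw [DomAddAct.mk_vadd_toLp, Lp.edist_toLp_toLp]
    congr 1
    funext p
    simp only [Pi.sub_apply, vadd_eq_add]
    rw [neg_add_eq_sub]
  have hc : Continuous fun z : V => edist (hf.toLp f) (DomAddAct.mk (-z) +ᵥ hf.toLp f) := by
    refine continuous_const.edist (continuous_vadd.comp (Continuous.prodMk ?_ continuous_const))
    exact DomAddAct.continuous_mk.comp continuous_neg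
  simp_rw [hF]
  have h := hc.tendsto 0
  have h0 : DomAddAct.mk (-(0 : V)) +ᵥ hf.toLp f = hf.toLp f := by
    rw [neg_zero, DomAddAct.mk_zero, zero_vadd]
  rwa [h0, edist_self] at h

lemma enorm_integral_sq_le {Z : Type*} [MeasurableSpace Z] {ν : Measure Z} [IsProbabilityMeasure ν]
    (g : Z → ℝ) : ‖∫ z, g z ∂ν‖ₑ ^ 2 ≤ ∫⁻ z, ENNReal.ofReal (g z ^ 2) ∂ν := by
  by_cases hg : Integrable g ν
  · rw [← eLpNorm_two_sq]
    refine pow_le_pow_left₀ zero_le ?_ 2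
    refine (enorm_integral_le_lintegral_enorm g).trans ?_
    rw [← eLpNorm_one_eq_lintegral_enorm]
    exact eLpNorm_le_eLpNorm_of_exponent_le (by norm_num) hg.aestronglyMeasurable
  · simp [integral_undef hg]

/-- Jensen for the probability measure `ν`, then Tonelli: an average of functions of small `L²` norm
has small `L²` norm. -/
lemma eLpNorm_integral_sq_le {X Z : Type*} [MeasurableSpace X] [MeasurableSpace Z] {μ : Measure X}
    [SFinite μ] {ν : Measure Z} [IsProbabilityMeasure ν] {Φ : Z → X → ℝ}
    (hΦ : Measurable (uncurry Φ)) {c : ℝ≥0∞} (hc : ∀ᵐ z ∂ν, eLpNorm (Φ z) 2 μ ^ 2 ≤ c) :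
    eLpNorm (fun x => ∫ z, Φ z x ∂ν) 2 μ ^ 2 ≤ c := by
  rw [eLpNorm_two_sq]
  calc ∫⁻ x, ENNReal.ofReal ((∫ z, Φ z x ∂ν) ^ 2) ∂μ
      ≤ ∫⁻ x, ∫⁻ z, ENNReal.ofReal (Φ z x ^ 2) ∂ν ∂μ := by
        refine lintegral_mono fun x => ?_
        refine le_trans (le_of_eq ?_) (enorm_integral_sq_le fun z => Φ z x)
        rw [← ofReal_norm, ← ENNReal.ofReal_pow (norm_nonneg _), Real.norm_eq_abs, sq_abs]
    _ = ∫⁻ z, ∫⁻ x, ENNReal.ofReal (Φ z x ^ 2) ∂μ ∂ν := by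
        refine lintegral_lintegral_swap ?_
        exact ((hΦ.comp measurable_swap).pow_const 2).ennreal_ofReal.aemeasurable
    _ ≤ ∫⁻ _, c ∂ν := by
        refine lintegral_mono_ae (hc.mono fun z hz => ?_)
        rwa [← eLpNorm_two_sq]
    _ = c := by simp

/-- `f` is a limit in `H^s` of nonnegative test functions supported in `Ω`. -/
def IsNonnegTestLimit (s : ℝ) (Ω : Set (Rn n)) (f : Rn n → ℝ) : Prop :=
  ∀ ε : ℝ≥0∞, 0 < ε → ∃ ψ, IsTestFunction Ω ψ ∧ (∀ x, 0 ≤ ψ x) ∧ hsNormSq s (f - ψ) < ε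

lemma IsTestFunction.add {Ω : Set (Rn n)} {φ ψ : Rn n → ℝ} (hφ : IsTestFunction Ω φ)
    (hψ : IsTestFunction Ω ψ) : IsTestFunction Ω (φ + ψ) :=
  ⟨hφ.1.add hψ.1, hφ.2.1.add hψ.2.1,
    (tsupport_add φ ψ).trans (union_subset hφ.2.2 hψ.2.2)⟩

lemma IsNonnegTestLimit.add {Ω : Set (Rn n)} {f g : Rn n → ℝ} (hf : IsNonnegTestLimit s Ω f)
    (hg : IsNonnegTestLimit s Ω g) (hfm : AEStronglyMeasurable f) (hgm : AEStronglyMeasurable g) :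
    IsNonnegTestLimit s Ω (f + g) := by
  intro ε hε
  have hε' : 0 < ε / 2 / 2 := ENNReal.half_pos (ENNReal.half_pos hε.ne').ne'
  obtain ⟨φ, hφ, hφ0, hφε⟩ := hf _ hε'
  obtain ⟨ψ, hψ, hψ0, hψε⟩ := hg _ hε'
  refine ⟨φ + ψ, hφ.add hψ, fun x => add_nonneg (hφ0 x) (hψ0 x), ?_⟩
  rw [add_sub_add_comm]
  refine (hsNormSq_add_le (hfm.sub hφ.1.continuous.aestronglyMeasurable)
    (hgm.sub hψ.1.continuous.aestronglyMeasurable)).trans_lt ?_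
  rw [two_mul, two_mul, ← ENNReal.add_halves ε, ← ENNReal.add_halves (ε / 2)]
  exact ENNReal.add_lt_add (ENNReal.add_lt_add hφε hφε) (ENNReal.add_lt_add hψε hψε)

/-- Convolution with a bump centred at the small vector `e` translates and mollifies at once. It
averages the translates `f (· - z)`, and `hsQuot` commutes with the diagonal translation by `(z,
z)`, so continuity of translations in `L²` controls both parts of the norm. -/
lemma isNonnegTestLimit_of_translate {Ω : Set (Rn n)} (hΩ : IsOpen Ω) {f : Rn n → ℝ}
    (hf : MemHs s f) (hfm : Measurable f) (hf0 : ∀ x, 0 ≤ f x) {K : Set (Rn n)} (hK : IsCompact K)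
    (hfK : ∀ x ∉ K, f x = 0)
    (htr : ∀ δ > 0, ∃ e : Rn n, ‖e‖ < δ ∧ ∀ x ∈ K, x + e ∈ Ω) : IsNonnegTestLimit s Ω f := by
  intro ε hε
  have hf' := memHs_iff.1 hf
  have hε2 : 0 < ε / 2 / 2 := ENNReal.half_pos (ENNReal.half_pos hε.ne').ne'
  obtain ⟨ε', hε'0, hε'⟩ := exists_between hε2
  have hGm : Measurable (hsQuot s f) :=
    ((hfm.comp measurable_fst).sub (hfm.comp measurable_snd)).div (measurable_hsQuot_weight _)
  have hdiag : Filter.Tendsto (fun z : Rn n => (z, z)) (nhds 0) (nhds (0, 0)) :=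
    (continuous_id.prodMk continuous_id).tendsto 0
  have : (volume : Measure (Rn n × Rn n)).IsAddLeftInvariant :=
    inferInstanceAs (Measure.prod volume volume).IsAddLeftInvariant
  have ht1 := ENNReal.Tendsto.pow (n := 2) (tendsto_eLpNorm_sub_translate hf'.1)
  have ht2 := ENNReal.Tendsto.pow (n := 2) ((tendsto_eLpNorm_sub_translate hf'.2).comp hdiag)
  rw [zero_pow two_ne_zero] at ht1 ht2
  obtain ⟨δ, hδ, hball⟩ := Metric.eventually_nhds_iff_ball.1
    ((ht1.eventually_lt_const hε'0).and (ht2.eventually_lt_const hε'0))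
  obtain ⟨e, he, hKe⟩ := htr (δ / 2) (by positivity)
  have hKc : IsCompact ((fun x => x + e) '' K) := hK.image (by fun_prop)
  obtain ⟨r, hr, hrΩ⟩ := hKc.exists_cthickening_subset_open hΩ (by rintro _ ⟨x, hx, rfl⟩; exact hKe x hx)
  have hmin : 0 < min r (δ / 2) := lt_min hr (by positivity)
  -- Radius at most `r` keeps the support of the convolution inside `Ω`; radius at most `δ / 2`,
  -- with `‖e‖ < δ / 2`, keeps every translation shorter than `δ`.
  let b : ContDiffBump e := ⟨min r (δ / 2) / 2, min r (δ / 2), by positivity, by linarith⟩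
  have hsuppη : support (b.normed volume) = Metric.ball e (min r (δ / 2)) := b.support_normed_eq
  set η : Rn n → ℝ := b.normed volume with hη
  have hη0 : ∀ z, 0 ≤ η z := fun z => b.nonneg_normed z
  have hηcont : Continuous η := b.continuous_normed
  have hηc : HasCompactSupport η := b.hasCompactSupport_normed
  have hηd : Measurable (fun z => ENNReal.ofReal (η z)) := hηcont.measurable.ennreal_ofReal
  let ν : Measure (Rn n) := volume.withDensity fun z => ENNReal.ofReal (η z)
  have hνp : IsProbabilityMeasure ν := by
    constructor
    rw [withDensity_apply _ MeasurableSet.univ, Measure.restrict_univ,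
      ← ofReal_integral_eq_lintegral_ofReal (hηcont.integrable_of_hasCompactSupport hηc)
        (Filter.Eventually.of_forall hη0), b.integral_normed, ENNReal.ofReal_one]
  have hνball : ∀ᵐ z ∂ν, z ∈ Metric.ball (0 : Rn n) δ := by
    refine (ae_withDensity_iff hηd).2 (Filter.Eventually.of_forall fun z hz => ?_)
    have hz' : z ∈ support η := fun h => hz (by simp [h])
    rw [hsuppη, mem_ball_iff_norm] at hz'
    rw [mem_ball_zero_iff]
    calc ‖z‖ = ‖(z - e) + e‖ := by rw [sub_add_cancel]
      _ ≤ ‖z - e‖ + ‖e‖ := norm_add_le _ _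
      _ < δ := by linarith [hz'.trans_le (min_le_right r (δ / 2))]
  have hloc : LocallyIntegrable f volume := hf'.1.locallyIntegrable (by norm_num)
  let L := ContinuousLinearMap.mul ℝ ℝ
  have hconv : ∀ x, convolution η f L volume x = ∫ z, f (x - z) ∂ν := fun x => by
    rw [integral_withDensity_eq_integral_toReal_smul hηd (by simp)]
    refine integral_congr_ae (Filter.Eventually.of_forall fun z => ?_)
    simp [L, ENNReal.toReal_ofReal (hη0 z)]
  have hint : ∀ x, Integrable (fun z => f (x - z)) ν := fun x => by
    rw [integrable_withDensity_iff_integrable_smul' hηd (by simp)]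
    refine ((hηc.convolutionExists_left L hηcont hloc) x).congr
      (Filter.Eventually.of_forall fun z => ?_)
    simp [L, ENNReal.toReal_ofReal (hη0 z)]
  have hsupp : tsupport (convolution η f L volume) ⊆
      Metric.cthickening r ((fun x => x + e) '' K) := by
    refine closure_minimal (fun x hx => ?_) Metric.isClosed_cthickening
    obtain ⟨z, hz, y, hy, rfl⟩ := support_convolution_subset L hx
    rw [hsuppη, mem_ball_iff_norm] at hz
    have hyK : y ∈ K := by
      by_contra h
      exact hy (hfK y h)
    refine Metric.mem_cthickening_of_dist_le _ (y + e) _ _ ⟨y, hyK, rfl⟩ ?_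
    rw [dist_eq_norm, show z + y - (y + e) = z - e by abel]
    exact hz.le.trans (min_le_left _ _)
  refine ⟨convolution η f L volume, ⟨?_, ?_, hsupp.trans hrΩ⟩, fun x => ?_, ?_⟩
  · exact hηc.contDiff_convolution_left (n := (⊤ : ℕ∞)) L b.contDiff_normed hloc
  · exact HasCompactSupport.of_support_subset_isCompact hKc.cthickening
      (subset_closure.trans hsupp)
  · rw [hconv]
    exact integral_nonneg fun z => hf0 _
  · have h1 : f - convolution η f L volume = fun x => ∫ z, (f x - f (x - z)) ∂ν := by
      funext x
      rw [integral_sub (integrable_const _) (hint x), Pi.sub_apply, hconv]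
      simp
    have h2 : hsQuot s (f - convolution η f L volume) =
        fun p => ∫ z, (hsQuot s f p - hsQuot s f (p - (z, z))) ∂ν := by
      funext p
      have hw : ∀ z, hsQuot s f p - hsQuot s f (p - (z, z)) =
          ((f p.1 - f (p.1 - z)) - (f p.2 - f (p.2 - z))) / ‖p.1 - p.2‖ ^ ((n : ℝ) / 2 + s) :=
        fun z => by
          simp only [hsQuot, Prod.fst_sub, Prod.snd_sub, sub_sub_sub_cancel_right]
          ring
      simp_rw [hw]
      rw [integral_div, integral_sub ((integrable_const _).sub' (hint _))
        ((integrable_const _).sub' (hint _)), h1]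
      rfl
    rw [hsNormSq_eq, h2, h1]
    have b1 : eLpNorm (fun x => ∫ z, (f x - f (x - z)) ∂ν) 2 volume ^ 2 ≤ ε' := by
      refine eLpNorm_integral_sq_le (Φ := fun z x => f x - f (x - z)) ?_
        (hνball.mono fun z hz => (hball z hz).1.le)
      exact (hfm.comp measurable_snd).sub (hfm.comp (measurable_snd.sub measurable_fst))
    have b2 : eLpNorm (fun p => ∫ z, (hsQuot s f p - hsQuot s f (p - (z, z))) ∂ν) 2 volume ^ 2
        ≤ ε' := by
      refine eLpNorm_integral_sq_le (Φ := fun z p => hsQuot s f p - hsQuot s f (p - (z, z))) ?_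
        (hνball.mono fun z hz => (hball z hz).2.le)
      exact (hGm.comp measurable_snd).sub (hGm.comp
        (measurable_snd.sub (measurable_fst.prodMk measurable_fst)))
    calc _ ≤ ε' + ε' := add_le_add b1 b2
      _ < ε / 2 / 2 + ε / 2 / 2 := ENNReal.add_lt_add hε' hε'
      _ = ε / 2 := ENNReal.add_halves _
      _ ≤ ε := ENNReal.half_le_self

end

section

variable {n : ℕ} {s : ℝ}

/-! ### Smooth boundaries -/

/-- Take `v` with `dρ(v) = 1` at `x₀`. Strict differentiability gives `ρ (y - t v) ≤ ρ y - t / 2`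
near `x₀`, and `ρ ≤ 0` on the closure by continuity. -/
lemma IsBoundedSmoothDomain.exists_inward {Ω : Set (Rn n)} (hΩ : IsBoundedSmoothDomain Ω)
    {x₀ : Rn n} (hx₀ : x₀ ∈ frontier Ω) :
    ∃ (R : ℝ) (v : Rn n), 0 < R ∧ v ≠ 0 ∧ ∀ y ∈ closure Ω ∩ Metric.ball x₀ R, ∀ t : ℝ, t > 0 →
      y - t • v ∈ Metric.ball x₀ R → y - t • v ∈ Ω := by
  obtain ⟨U, ρ, hU, hxU, hρ, hd, hsub⟩ := hΩ.smooth_boundary x₀ hx₀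
  have hcd : ContDiffAt ℝ ∞ ρ x₀ := hρ.contDiffAt (hU.mem_nhds hxU)
  have hst := hcd.hasStrictFDerivAt (by simp)
  set T := fderiv ℝ ρ x₀
  obtain ⟨w, hw⟩ : ∃ w, T w ≠ 0 := by
    by_contra! h
    exact hd (ContinuousLinearMap.ext h)
  obtain ⟨v, hv⟩ : ∃ v, T v = 1 := ⟨(T w)⁻¹ • w, by simp [hw]⟩
  have hv0 : v ≠ 0 := by
    rintro rfl
    simp at hv
  have hv0' : 0 < ‖v‖ := norm_pos_iff.2 hv0
  -- This constant makes the linearization error over the step `t v` at most `t / 2`.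
  have hlo := hst.isLittleO.def (c := 1 / (2 * ‖v‖)) (by positivity)
  rw [nhds_prod_eq] at hlo
  obtain ⟨V, hV, hVb⟩ := Filter.mem_prod_self_iff.1 hlo
  obtain ⟨R, hR, hball⟩ := Metric.mem_nhds_iff.1 (Filter.inter_mem hV (hU.mem_nhds hxU))
  refine ⟨R, v, hR, hv0, fun y hy t ht hyt => ?_⟩
  have hyU : y ∈ U := (hball hy.2).2
  have hρy : ρ y ≤ 0 := by
    by_contra! hpos
    have hc : ContinuousAt ρ y := hρ.continuousOn.continuousAt (hU.mem_nhds hyU)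
    have hmem : {z | z ∈ U ∧ 0 < ρ z} ∈ nhds y :=
      Filter.inter_mem (hU.mem_nhds hyU) (hc.eventually_const_lt hpos)
    obtain ⟨z, hz, hzΩ⟩ := mem_closure_iff_nhds.1 hy.1 _ hmem
    linarith [(hsub z hz.1).1 hzΩ, hz.2]
  have h := hVb (mk_mem_prod (hball hyt).1 (hball hy.2).1)
  simp only [mem_ofPred_eq, sub_sub_cancel_left, map_neg, map_smul, hv, smul_eq_mul, mul_one, norm_neg, norm_smul,
    Real.norm_of_nonneg ht.le] at h
  have h' : 1 / (2 * ‖v‖) * (t * ‖v‖) = t / 2 := by field_simp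
  rw [h', Real.norm_eq_abs] at h
  exact (hsub _ (hball hyt).2).2 (by linarith [(abs_le.1 h).2])

/-- Locally, each line in direction `v` meets the frontier at most once, since moving inward from a
frontier point lands in the open set `Ω`. Fubini along `v` concludes. -/
lemma IsBoundedSmoothDomain.volume_frontier {Ω : Set (Rn n)} (hΩ : IsBoundedSmoothDomain Ω) :
    volume (frontier Ω) = 0 := by
  refine measure_null_of_locally_null _ fun x hx => ?_
  obtain ⟨R, v, hR, hv, hin⟩ := hΩ.exists_inward hx
  refine ⟨frontier Ω ∩ Metric.ball x R, inter_mem_nhdsWithin _ (Metric.ball_mem_nhds x hR), ?_⟩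
  have hm : MeasurableSet (frontier Ω ∩ Metric.ball x R)ᶜ :=
    (isClosed_frontier.measurableSet.inter measurableSet_ball).compl
  have key := ae_mem_of_ae_add_linearMap_mem (LinearMap.toSpanSingleton ℝ (Rn n) v) volume volume hm
    fun y => by
      have hsub : {t : ℝ | y + t • v ∈ frontier Ω ∩ Metric.ball x R}.Subsingleton := by
        have aux : ∀ a b : ℝ, a < b → y + a • v ∈ frontier Ω ∩ Metric.ball x R →
            y + b • v ∈ frontier Ω ∩ Metric.ball x R → False := fun a b hab ha hb => by
          have he : y + b • v - (b - a) • v = y + a • v := by module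
          have := hin _ ⟨frontier_subset_closure hb.1, hb.2⟩ (b - a) (sub_pos.2 hab)
            (he ▸ ha.2)
          rw [he] at this
          exact (hΩ.isOpen.frontier_eq ▸ ha.1).2 this
        intro a ha b hb
        rcases lt_trichotomy a b with h | h | h
        · exact (aux a b h ha hb).elim
        · exact h
        · exact (aux b a h hb ha).elim
      have hz := hsub.measure_zero volume
      rw [← compl_mem_ae_iff] at hz
      filter_upwards [hz] with t ht
      exact ht
  have h0 := mem_ae_iff.1 key
  rwa [ofPred_mem_eq, compl_compl] at h0

lemma IsBoundedSmoothDomain.exists_translate {Ω : Set (Rn n)} (hΩ : IsBoundedSmoothDomain Ω)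
    {x₀ : Rn n} (hx₀ : x₀ ∈ closure Ω) :
    ∃ r > 0, ∀ δ > 0, ∃ e : Rn n, ‖e‖ < δ ∧ ∀ x ∈ closure Ω ∩ Metric.closedBall x₀ r, x + e ∈ Ω := by
  by_cases hx : x₀ ∈ Ω
  · obtain ⟨r, hr, hball⟩ := Metric.nhds_basis_closedBall.mem_iff.1 (hΩ.isOpen.mem_nhds hx)
    exact ⟨r, hr, fun δ hδ => ⟨0, by simpa using hδ, fun x hx => by simpa using hball hx.2⟩⟩
  · have hfr : x₀ ∈ frontier Ω := hΩ.isOpen.frontier_eq ▸ ⟨hx₀, hx⟩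
    obtain ⟨R, v, hR, hv, hin⟩ := hΩ.exists_inward hfr
    have hv' : 0 < ‖v‖ := norm_pos_iff.2 hv
    refine ⟨R / 2, by positivity, fun δ hδ => ?_⟩
    have hm : 0 < min δ (R / 2) := lt_min hδ (by positivity)
    have ht : 0 < min δ (R / 2) / (2 * ‖v‖) := by positivity
    have hn : ‖(min δ (R / 2) / (2 * ‖v‖)) • v‖ = min δ (R / 2) / 2 := by
      rw [norm_smul, Real.norm_of_nonneg ht.le]
      field_simp
    refine ⟨-((min δ (R / 2) / (2 * ‖v‖)) • v), ?_, fun x hx => ?_⟩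
    · rw [norm_neg, hn]
      linarith [min_le_left δ (R / 2)]
    · rw [← sub_eq_add_neg]
      have hxb := mem_closedBall_iff_norm.1 hx.2
      refine hin x ⟨hx.1, mem_ball_iff_norm.2 (by linarith)⟩ _ ht (mem_ball_iff_norm.2 ?_)
      rw [sub_right_comm]
      refine (norm_sub_le _ _).trans_lt ?_
      rw [hn]
      linarith [min_le_right δ (R / 2)]

lemma isNonnegTestLimit_zero {Ω : Set (Rn n)} : IsNonnegTestLimit s Ω (0 : Rn n → ℝ) := by
  intro ε hε
  refine ⟨0, ⟨contDiff_const, HasCompactSupport.zero, by simp⟩, fun _ => le_rfl, ?_⟩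
  have h0 : hsQuot s (0 : Rn n → ℝ) = 0 := by
    funext p
    simp [hsQuot]
  rw [sub_zero, hsNormSq_eq, h0]
  simpa using hε

lemma isNonnegTestLimit_of_finset (hs0 : 0 < s) (hs1 : s < 1) (hn : 1 ≤ n)
    {Ω : Set (Rn n)} (hΩ : IsBoundedSmoothDomain Ω) (r : Rn n → ℝ) (hr : ∀ c, 0 < r c)
    (T : Finset (Rn n))
    (htr : ∀ c ∈ T, ∀ δ > 0, ∃ e : Rn n, ‖e‖ < δ ∧
      ∀ x ∈ closure Ω ∩ Metric.closedBall c (r c), x + e ∈ Ω)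
    {f : Rn n → ℝ} (hf : MemHs s f) (hfm : Measurable f) (hf0 : ∀ x, 0 ≤ f x)
    (hfΩ : ∀ x ∉ closure Ω, f x = 0)
    (hfT : ∀ x, f x ≠ 0 → ∃ c ∈ T, x ∈ Metric.closedBall c (r c / 2)) :
    IsNonnegTestLimit s Ω f := by
  classical
  induction T using Finset.induction_on generalizing f with
  | empty =>
    have : f = 0 := by
      funext x
      by_contra h
      simpa using hfT x h
    exact this ▸ isNonnegTestLimit_zero
  | insert c T hc ih =>
    -- `χ f` lives in one translatable patch; `(1 - χ) f` vanishes on the half-radius ball about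
    -- `c`, so the remaining centres cover it.
    let χ : ContDiffBump c := ⟨r c / 2, r c, by linarith [hr c], by linarith [hr c]⟩
    have hχ : ContDiff ℝ ∞ (χ : Rn n → ℝ) := χ.contDiff
    obtain ⟨K, hK⟩ := hχ.lipschitzWith_of_hasCompactSupport χ.hasCompactSupport (by simp)
    have hK' : LipschitzWith K (fun x => 1 - χ x) := by
      simpa using (LipschitzWith.const (α := Rn n) (1 : ℝ)).sub hK
    have hb1 : ∀ x, |χ x| ≤ 1 := fun x => by
      rw [abs_of_nonneg χ.nonneg]
      exact χ.le_one
    have hb2 : ∀ x, |1 - χ x| ≤ 1 := fun x => by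
      rw [abs_of_nonneg (sub_nonneg.2 χ.le_one)]
      linarith [χ.nonneg' x]
    have hf1 : MemHs s (fun x => χ x * f x) := hf.lipschitz_mul hs0 hs1 hn hK hb1
    have hf2 : MemHs s (fun x => (1 - χ x) * f x) := hf.lipschitz_mul hs0 hs1 hn hK' hb2
    have hm1 : Measurable (fun x => χ x * f x) := χ.continuous.measurable.mul hfm
    have hm2 : Measurable (fun x => (1 - χ x) * f x) :=
      (measurable_const.sub χ.continuous.measurable).mul hfm
    have hsum : f = (fun x => χ x * f x) + fun x => (1 - χ x) * f x := by
      funext x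
      simp only [Pi.add_apply]
      ring
    rw [hsum]
    refine IsNonnegTestLimit.add ?_ ?_ hm1.aestronglyMeasurable hm2.aestronglyMeasurable
    · refine isNonnegTestLimit_of_translate hΩ.isOpen hf1 hm1
        (fun x => mul_nonneg χ.nonneg (hf0 x))
        ((isCompact_closedBall c (r c)).inter_left isClosed_closure) (fun x hx => ?_)
        (htr c (Finset.mem_insert_self c T))
      by_cases hxΩ : x ∈ closure Ω
      · rw [χ.zero_of_le_dist, zero_mul]
        by_contra! h
        exact hx ⟨hxΩ, h.le⟩
      · rw [hfΩ x hxΩ, mul_zero]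
    · refine ih (fun c' hc' => htr c' (Finset.mem_insert_of_mem hc')) hf2 hm2
        (fun x => mul_nonneg (sub_nonneg.2 χ.le_one) (hf0 x))
        (fun x hx => by rw [hfΩ x hx, mul_zero]) fun x hx => ?_
      obtain ⟨c', hc', hxc'⟩ := hfT x (right_ne_zero_of_mul hx)
      rcases Finset.mem_insert.1 hc' with rfl | h
      · exact absurd (by rw [χ.one_of_mem_closedBall hxc', sub_self]) (left_ne_zero_of_mul hx)
      · exact ⟨c', h, hxc'⟩

/-- Nonnegative `H^s` functions vanishing outside a smooth domain are limits of nonnegative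
test functions. -/
lemma IsBoundedSmoothDomain.isNonnegTestLimit (hs0 : 0 < s) (hs1 : s < 1) (hn : 1 ≤ n)
    {Ω : Set (Rn n)} (hΩ : IsBoundedSmoothDomain Ω) {f : Rn n → ℝ} (hf : MemHs s f)
    (hf0 : ∀ x, 0 ≤ f x) (hfΩ : f =ᵐ[volume.restrict (ext Ω)] 0) : IsNonnegTestLimit s Ω f := by
  have hcm : MeasurableSet (closure Ω) := isClosed_closure.measurableSet
  -- A measurable, nonnegative representative that vanishes everywhere, not just almost everywhere,
  -- off `closure Ω`.
  let f₁ : Rn n → ℝ := (closure Ω).indicator fun x => max (hf.1.1.mk f x) 0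
  have hm : Measurable f₁ :=
    (hf.1.1.stronglyMeasurable_mk.measurable.max measurable_const).indicator hcm
  have hae : f =ᵐ[volume] f₁ := by
    have h1 := hf.1.1.ae_eq_mk
    have h2 := (ae_restrict_iff' hcm.compl).1 hfΩ
    filter_upwards [h1, h2] with x hx1 hx2
    by_cases hx : x ∈ closure Ω
    · simp only [f₁, indicator_of_mem hx]
      rw [← hx1, max_eq_left (hf0 x)]
    · simp only [f₁, indicator_of_notMem hx]
      exact hx2 hx
  have htr : ∀ c : Rn n, ∃ r > 0, c ∈ closure Ω → ∀ δ > 0, ∃ e : Rn n, ‖e‖ < δ ∧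
      ∀ x ∈ closure Ω ∩ Metric.closedBall c r, x + e ∈ Ω := fun c => by
    by_cases hc : c ∈ closure Ω
    · obtain ⟨r, hr, h⟩ := hΩ.exists_translate hc
      exact ⟨r, hr, fun _ => h⟩
    · exact ⟨1, one_pos, fun h => (hc h).elim⟩
  choose r hr htr using htr
  obtain ⟨T, hT, hcov⟩ := hΩ.isBounded.isCompact_closure.elim_nhds_subcover
    (fun c => Metric.closedBall c (r c / 2))
    fun c _ => Metric.closedBall_mem_nhds c (by linarith [hr c])
  have h := isNonnegTestLimit_of_finset hs0 hs1 hn hΩ r hr T (fun c hc => htr c (hT c hc))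
    (hf.congr_ae hae) hm (fun x => indicator_nonneg (fun _ _ => le_max_right _ _) x)
    (fun x hx => indicator_of_notMem hx _) fun x hx => by
      obtain ⟨c, hc, hxc⟩ := mem_iUnion₂.1 (hcov (mem_of_indicator_ne_zero hx))
      exact ⟨c, hc, hxc⟩
  intro ε hε
  obtain ⟨ψ, hψ, hψ0, hψε⟩ := h ε hε
  refine ⟨ψ, hψ, hψ0, ?_⟩
  rwa [hsNormSq_congr_ae (hae.sub (ae_eq_refl ψ))]

end

section

variable {n : ℕ} {s : ℝ} {Ω : Set (Rn n)} {A : Rn n → Rn n → Rn n}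

/-! ### Bilinearity and boundedness of the magnetic form -/

lemma magGrad_neg (s : ℝ) (A : Rn n → Rn n → Rn n) (u : Rn n → ℝ) (x y : Rn n) :
    magGrad s A (-u) x y = -magGrad s A u x y := by
  simp only [magGrad, fracGrad, Pi.neg_apply]
  module

lemma magForm_neg_left (s : ℝ) (A : Rn n → Rn n → Rn n) (u v : Rn n → ℝ) :
    magForm s A (-u) v = -magForm s A u v := by
  simp only [magForm, magGrad_neg, inner_neg_left, integral_neg]

lemma magForm_comm (s : ℝ) (A : Rn n → Rn n → Rn n) (u v : Rn n → ℝ) :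
    magForm s A u v = magForm s A v u := by
  simp only [magForm, real_inner_comm]

lemma magForm_self_nonneg (s : ℝ) (A : Rn n → Rn n → Rn n) (u : Rn n → ℝ) :
    0 ≤ magForm s A u u :=
  integral_nonneg fun _ => real_inner_self_nonneg

lemma magGrad_sub_smul (s : ℝ) (A : Rn n → Rn n → Rn n) (u v : Rn n → ℝ) (c : ℝ) (x y : Rn n) :
    magGrad s A (u - c • v) x y = magGrad s A u x y - c • magGrad s A v x y := by
  simp only [magGrad, fracGrad, Pi.sub_apply, Pi.smul_apply, smul_eq_mul]
  module

lemma IsAdmissible.integrable_magForm (hs0 : 0 < s) (hs1 : s < 1) (hn : 2 ≤ n)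
    (hA : IsAdmissible s Ω A) {u v : Rn n → ℝ} (hu : MemHs s u) (hv : MemHs s v) :
    Integrable fun p : Rn n × Rn n =>
      (inner ℝ (magGrad s A u p.1 p.2) (magGrad s A v p.1 p.2) : ℝ) := by
  rw [memHs_iff] at hu hv
  have hm := hA.isDominatedKernel_magKernel hs0 hs1 hn
  have hb := hA.isDominatedKernel_norm_sq hs0
  have huv : Integrable (fun x => u x * v x) := hu.1.integrable_mul hv.1
  have hG : Integrable (fun p => hsQuot s u p * hsQuot s v p) := hu.2.integrable_mul hv.2
  refine ((((hG.const_mul (fracConst n s / 2)).add ((hm.integrable_mul_fst huv).const_mul 2)).sub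
    ((hm.integrable_mul_prod hv.1 hu.1).add (hm.integrable_mul_prod hu.1 hv.1))).add
    (hb.integrable_mul_fst huv)).congr (Filter.Eventually.of_forall fun p => ?_)
  simp only [inner_magGrad hs0 hs1, Pi.sub_apply, Pi.add_apply]
  ring

lemma IsAdmissible.magForm_sub_smul_left (hs0 : 0 < s) (hs1 : s < 1) (hn : 2 ≤ n)
    (hA : IsAdmissible s Ω A) {u v w : Rn n → ℝ} (hu : MemHs s u) (hv : MemHs s v)
    (hw : MemHs s w) (c : ℝ) :
    magForm s A (u - c • v) w = magForm s A u w - c * magForm s A v w := by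
  unfold magForm
  rw [← integral_const_mul, ← integral_sub (hA.integrable_magForm hs0 hs1 hn hu hw)
    ((hA.integrable_magForm hs0 hs1 hn hv hw).const_mul c)]
  simp only [magGrad_sub_smul, inner_sub_left, inner_smul_left, RCLike.conj_to_real]

lemma IsDominatedKernel.exists_integral_le {c : Rn n × Rn n → ℝ} (hc : IsDominatedKernel c) :
    ∃ H : ℝ, 0 ≤ H ∧ ∀ f : Rn n → ℝ, Integrable f → (∀ x, 0 ≤ f x) →
      ∫ p, c p * f p.1 ≤ H * ∫ x, f x := by
  obtain ⟨hm, h, hi, hb⟩ := hc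
  have hh : ∀ z, 0 ≤ h z := fun z => by simpa using (abs_nonneg _).trans (hb (z, 0))
  have hk : IsDominatedKernel (fun p : Rn n × Rn n => h (p.1 - p.2)) :=
    ⟨hi.1.comp_quasiMeasurePreserving (quasiMeasurePreserving_sub volume volume), h, hi,
      fun p => by rw [abs_of_nonneg (hh _)]⟩
  refine ⟨∫ z, h z, integral_nonneg hh, fun f hf hf0 => ?_⟩
  calc ∫ p, c p * f p.1 ≤ ∫ p : Rn n × Rn n, h (p.1 - p.2) * f p.1 := by
        refine integral_mono (IsDominatedKernel.integrable_mul_fst ⟨hm, h, hi, hb⟩ hf)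
          (hk.integrable_mul_fst hf) fun p => ?_
        exact mul_le_mul_of_nonneg_right ((le_abs_self _).trans (hb p)) (hf0 _)
    _ = (∫ z, h z) * ∫ x, f x := by
        rw [hk.integral_mul_fst hf, ← integral_const_mul]
        simp only [integral_sub_left_eq_self]

lemma integral_sq_eq {X : Type*} [MeasurableSpace X] {μ : Measure X} {f : X → ℝ}
    (hf : MemLp f 2 μ) : ∫ x, f x ^ 2 ∂μ = (eLpNorm f 2 μ ^ 2).toReal := by
  rw [eLpNorm_two_sq, integral_eq_lintegral_of_nonneg_ae
    (Filter.Eventually.of_forall fun _ => sq_nonneg _) (hf.1.pow 2)]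

lemma MemHs.hsNormSq_toReal {f : Rn n → ℝ} (hf : MemHs s f) :
    (hsNormSq s f).toReal = (∫ x, f x ^ 2) + ∫ p, hsQuot s f p ^ 2 := by
  rw [memHs_iff] at hf
  rw [hsNormSq_eq, integral_sq_eq hf.1, integral_sq_eq hf.2, ENNReal.toReal_add]
  · exact (ENNReal.pow_lt_top hf.1.2).ne
  · exact (ENNReal.pow_lt_top hf.2.2).ne

/-- The `β` and `q` terms are bounded by the `L²` norm through the dominated kernels, with `(a - b)²
≤ 2a² + 2b²` and the symmetry of `β`. -/
lemma IsAdmissible.exists_magForm_self_le (hs0 : 0 < s) (hs1 : s < 1) (hn : 2 ≤ n)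
    (hA : IsAdmissible s Ω A) : ∃ H : ℝ, 0 ≤ H ∧ ∀ g : Rn n → ℝ, MemHs s g →
      magForm s A g g ≤ H * (hsNormSq s g).toReal := by
  have hβ := hA.isDominatedKernel_symKernel hs0 hs1 hn
  have hq := hA.isDominatedKernel_potKernel hs0 hs1 hn
  obtain ⟨H₁, hH₁, hb₁⟩ := hβ.exists_integral_le
  obtain ⟨H₂, hH₂, hb₂⟩ := hq.exists_integral_le
  have hC := fracConst_pos (n := n) hs0 hs1
  refine ⟨fracConst n s / 2 + 4 * H₁ + H₂, by positivity, fun g hg => ?_⟩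
  rw [hA.magForm_eq hs0 hs1 hn hg hg, hg.hsNormSq_toReal]
  have hg' := memHs_iff.1 hg
  have hsq := hg'.1.integrable_sq
  have hsym : ∀ p, symKernel s A p.swap = symKernel s A p := fun p => by
    simp only [symKernel, Prod.swap_swap]
    ring
  have e2 : ∫ p : Rn n × Rn n, symKernel s A p * g p.2 ^ 2 =
      ∫ p : Rn n × Rn n, symKernel s A p * g p.1 ^ 2 := by
    have h := integral_prod_swap (μ := (volume : Measure (Rn n))) (ν := (volume : Measure (Rn n)))
      (fun p : Rn n × Rn n => symKernel s A p * g p.2 ^ 2)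
    simp only [hsym, Prod.snd_swap] at h
    exact h.symm
  have hle : ∫ p, symKernel s A p * ((g p.1 - g p.2) * (g p.1 - g p.2)) ≤
      4 * H₁ * ∫ x, g x ^ 2 := by
    have hi1 := (hβ.integrable_mul_fst hsq).const_mul 2
    have hi2 := (hβ.integrable_mul_snd hsq).const_mul 2
    calc _ ≤ ∫ p : Rn n × Rn n, (2 * (symKernel s A p * g p.1 ^ 2) +
          2 * (symKernel s A p * g p.2 ^ 2)) := by
          refine integral_mono (hβ.integrable_mul_diff_mul_diff hg'.1 hg'.1) (hi1.add hi2)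
            fun p => ?_
          simp only
          nlinarith [mul_nonneg (hA.symKernel_nonneg p) (sq_nonneg (g p.1 + g p.2))]
      _ = 4 * ∫ p : Rn n × Rn n, symKernel s A p * g p.1 ^ 2 := by
          rw [integral_add hi1 hi2, integral_const_mul, integral_const_mul, e2]
          ring
      _ ≤ _ := by linarith [hb₁ _ hsq fun x => sq_nonneg _]
  have h3 : ∫ x, potential s A x * (g x * g x) ≤ H₂ * ∫ x, g x ^ 2 := by
    have h := hb₂ _ hsq fun x => sq_nonneg _
    rw [hq.integral_mul_fst hsq] at h
    simpa only [pow_two, potential] using h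
  have h1 : ∫ p, hsQuot s g p * hsQuot s g p = ∫ p, hsQuot s g p ^ 2 := by simp only [pow_two]
  rw [h1]
  have p1 : 0 ≤ ∫ x, g x ^ 2 := integral_nonneg fun _ => sq_nonneg _
  have p2 : 0 ≤ ∫ p, hsQuot s g p ^ 2 := integral_nonneg fun _ => sq_nonneg _
  nlinarith [mul_nonneg hH₁ p2, mul_nonneg hH₂ p2, mul_nonneg hC.le p1]

/-! ### Comparison with a barrier -/

lemma integrable_of_eq_zero_on_ext (hΩ : IsBoundedSmoothDomain Ω) {f : Rn n → ℝ}
    (hf : MemLp f 2) (hfΩ : f =ᵐ[volume.restrict (ext Ω)] 0) : Integrable f := by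
  have hcm : MeasurableSet (closure Ω) := isClosed_closure.measurableSet
  have hfin : volume (closure Ω) ≠ ⊤ := hΩ.isBounded.isCompact_closure.measure_lt_top.ne
  have : IsFiniteMeasure (volume.restrict (closure Ω)) := ⟨by simpa using hfin.lt_top⟩
  have h1 : IntegrableOn f (closure Ω) := (hf.restrict _).integrable (by norm_num)
  have h2 : IntegrableOn f (ext Ω) := (integrable_zero _ _ _).congr hfΩ.symm
  rw [← integrableOn_univ, ← union_compl_self (closure Ω)]
  exact h1.union h2

/-- Extends the barrier inequality by density: both sides are continuous in `H^s` along nonnegative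
test functions supported in `Ω`. -/
lemma IsBarrier.integral_le_magForm (hs0 : 0 < s) (hs1 : s < 1) (hn : 2 ≤ n)
    (hΩ : IsBoundedSmoothDomain Ω) (hA : IsAdmissible s Ω A) {C : ℝ} {φ f : Rn n → ℝ}
    (hφ : IsBarrier s Ω A C φ) (hf : MemHs s f) (hf0 : ∀ x, 0 ≤ f x)
    (hfΩ : f =ᵐ[volume.restrict (ext Ω)] 0) : ∫ x, f x ≤ magForm s A φ f := by
  obtain ⟨H, hH, hbd⟩ := hA.exists_magForm_self_le hs0 hs1 hn
  have hφs : MemHs s φ := memHs_of_contDiff hs0 hs1 (by omega) hφ.smooth hφ.compact_support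
  have hlim := hΩ.isNonnegTestLimit hs0 hs1 (by omega) hf hf0 hfΩ
  have hfi := integrable_of_eq_zero_on_ext hΩ hf.1 hfΩ
  have hcm : MeasurableSet (closure Ω) := isClosed_closure.measurableSet
  have hDi : Integrable ((closure Ω).indicator fun _ => (1 : ℝ)) :=
    (integrable_indicator_iff hcm).2
      (integrableOn_const hΩ.isBounded.isCompact_closure.measure_lt_top.ne)
  have hD0 : 0 ≤ ∫ x, (closure Ω).indicator (fun _ => (1 : ℝ)) x :=
    integral_nonneg fun x => indicator_nonneg (fun _ _ => zero_le_one) x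
  set D := ∫ x, (closure Ω).indicator (fun _ => (1 : ℝ)) x
  have hQ := magForm_self_nonneg s A φ
  set Q := magForm s A φ φ
  -- Choose `ψ` within `t` of `f` in `H^s`. Cauchy–Schwarz in the form `2ab ≤ t²a² + b²` style
  -- bounds costs `t² (Q + H)` for the form and `t² (D + 1)` for the integral; dividing by `t`
  -- leaves an error of order `t`.
  have key : ∀ t > 0, 2 * ((∫ x, f x) - magForm s A φ f) ≤ t * (Q + D + H + 1) := fun t ht => by
    obtain ⟨ψ, hψ, hψ0, hψt⟩ := hlim (ENNReal.ofReal (t ^ 2)) (ENNReal.ofReal_pos.2 (by positivity))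
    have hψs : MemHs s ψ := memHs_of_contDiff hs0 hs1 (by omega) hψ.1 hψ.2.1
    have hg : MemHs s (f - ψ) := hf.sub hψs
    have hψi : Integrable ψ := hψ.1.continuous.integrable_of_hasCompactSupport hψ.2.1
    have hψt' : (hsNormSq s (f - ψ)).toReal ≤ t ^ 2 :=
      ENNReal.toReal_le_of_le_ofReal (by positivity) hψt.le
    have h1 := hφ.one_le ψ hψ hψ0
    have h2 : magForm s A φ (f - ψ) = magForm s A φ f - magForm s A φ ψ := by
      have h := hA.magForm_sub_smul_left hs0 hs1 hn hf hψs hφs 1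
      rw [one_smul, one_mul] at h
      rw [magForm_comm, h, magForm_comm s A f, magForm_comm s A ψ]
    have h3 : -2 * t * magForm s A φ (f - ψ) ≤ t ^ 2 * Q + magForm s A (f - ψ) (f - ψ) := by
      -- Expand the square of `(f - ψ) + t φ`.
      have h := magForm_self_nonneg s A ((f - ψ) - (-t) • φ)
      rw [hA.magForm_sub_smul_left hs0 hs1 hn hg hφs (hg.sub (hφs.const_smul _)),
        magForm_comm s A (f - ψ), magForm_comm s A φ,
        hA.magForm_sub_smul_left hs0 hs1 hn hg hφs hg,
        hA.magForm_sub_smul_left hs0 hs1 hn hg hφs hφs, magForm_comm s A (f - ψ) φ] at h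
      nlinarith
    have h4 : 2 * t * ∫ x, (f - ψ) x ≤ t ^ 2 * D + ∫ x, (f - ψ) x ^ 2 := by
      rw [← integral_const_mul, ← integral_const_mul,
        ← integral_add (hDi.const_mul _) hg.1.integrable_sq]
      refine integral_mono_ae ((hfi.sub hψi).const_mul _)
        ((hDi.const_mul _).add hg.1.integrable_sq) ?_
      filter_upwards [(ae_restrict_iff' hcm.compl).1 hfΩ] with x hx
      by_cases hxD : x ∈ closure Ω
      · simp only [indicator_of_mem hxD]
        nlinarith [sq_nonneg (t - (f - ψ) x)]
      · have hψx : ψ x = 0 := image_eq_zero_of_notMem_tsupport fun h =>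
          hxD (subset_closure (hψ.2.2 h))
        have hfx : f x = 0 := hx hxD
        simp [indicator_of_notMem hxD, hψx, hfx]
    have h5 : ∫ x, (f - ψ) x = (∫ x, f x) - ∫ x, ψ x := integral_sub hfi hψi
    have h6 := hbd _ hg
    have h7 : ∫ x, (f - ψ) x ^ 2 ≤ (hsNormSq s (f - ψ)).toReal := by
      rw [hg.hsNormSq_toReal]
      exact le_add_of_nonneg_right (integral_nonneg fun _ => sq_nonneg _)
    have h8 : t * (2 * ((∫ x, f x) - magForm s A φ f)) ≤ t * (t * (Q + D + H + 1)) := by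
      have h9 : t * (∫ x, ψ x) ≤ t * magForm s A φ ψ := mul_le_mul_of_nonneg_left h1 ht.le
      rw [h5] at h4
      rw [h2] at h3
      have h10 := mul_le_mul_of_nonneg_left hψt' hH
      nlinarith
    exact le_of_mul_le_mul_left h8 ht
  by_contra! hlt
  have hK : 0 < Q + D + H + 1 := by linarith
  -- With this `t` the estimate reads `2d ≤ d` for the positive defect `d`.
  have h := key (((∫ x, f x) - magForm s A φ f) / (Q + D + H + 1))
    (div_pos (sub_pos.2 hlt) hK)
  rw [div_mul_cancel₀ _ hK.ne'] at h
  linarith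

end

section

variable {n : ℕ} {s : ℝ} {Ω : Set (Rn n)} {A : Rn n → Rn n → Rn n}

/-! ### The maximum principle -/

lemma nontrivial_Rn (hn : 1 ≤ n) : Nontrivial (Rn n) := by
  have : Nonempty (Fin n) := ⟨⟨0, hn⟩⟩
  infer_instance

lemma IsBoundedSmoothDomain.volume_ext_pos (hn : 1 ≤ n) (hΩ : IsBoundedSmoothDomain Ω) :
    0 < volume (ext Ω) := by
  have := nontrivial_Rn hn
  refine isClosed_closure.isOpen_compl.measure_pos _ ?_
  rw [nonempty_compl]
  intro h
  obtain ⟨R, hR⟩ := hΩ.isBounded.isCompact_closure.isBounded.subset_closedBall (0 : Rn n)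
  obtain ⟨x, hx⟩ := NormedSpace.exists_lt_norm ℝ (Rn n) R
  have := hR (h ▸ mem_univ x)
  rw [mem_closedBall_zero_iff] at this
  linarith

lemma IsBoundedSmoothDomain.ae_mem_or_ext (hΩ : IsBoundedSmoothDomain Ω) :
    ∀ᵐ x : Rn n, x ∈ Ω ∨ x ∈ ext Ω := by
  have h := measure_eq_zero_iff_ae_notMem.1 hΩ.volume_frontier
  filter_upwards [h] with x hx
  by_cases hc : x ∈ closure Ω
  · left
    by_contra hxΩ
    exact hx (hΩ.isOpen.frontier_eq ▸ ⟨hc, hxΩ⟩)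
  · exact Or.inr hc

lemma IsNonnegTestLimit.memHsTilde {f : Rn n → ℝ} (h : IsNonnegTestLimit s Ω f) (hf : MemHs s f) :
    MemHsTilde s Ω f :=
  ⟨hf, fun ε hε => (h ε hε).imp fun _ h => ⟨h.1, h.2.2⟩⟩

/-- The exterior has positive measure, so almost every `x` can be compared with an exterior point
`y` where `f y = 0`. -/
lemma ae_eq_zero_of_hsQuot_ae_eq_zero (hn : 1 ≤ n) (hΩ : IsBoundedSmoothDomain Ω) {f : Rn n → ℝ}
    (hf : hsQuot s f =ᵐ[volume] 0) (hfΩ : f =ᵐ[volume.restrict (ext Ω)] 0) :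
    f =ᵐ[volume] 0 := by
  have h1 : ∀ᵐ x : Rn n, ∀ᵐ y : Rn n, hsQuot s f (x, y) = 0 := Measure.ae_ae_of_ae_prod hf
  have hm : MeasurableSet (ext Ω) := isClosed_closure.isOpen_compl.measurableSet
  have hpos := hΩ.volume_ext_pos hn
  filter_upwards [h1] with x hx
  have hne : (ae (volume.restrict (ext Ω))).NeBot := by
    rw [ae_neBot]
    intro h
    rw [Measure.restrict_eq_zero] at h
    exact hpos.ne' h
  obtain ⟨y, hy, hfy⟩ := ((ae_restrict_of_ae hx).and hfΩ).exists
  rw [Pi.zero_apply] at hfy ⊢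
  rcases eq_or_ne x y with rfl | hxy
  · exact hfy
  have hw : ‖x - y‖ ^ ((n : ℝ) / 2 + s) ≠ 0 :=
    (Real.rpow_pos_of_pos (norm_pos_iff.2 (sub_ne_zero.2 hxy)) _).ne'
  have := (div_eq_zero_iff.1 hy).resolve_right hw
  simp only [hfy, sub_zero] at this
  exact this

/-- Truncation is monotone and 1-Lipschitz; this gives the sign of the jump form and the lower bound
for the Gagliardo form. -/
lemma max_sub_max_sq_le (a b M : ℝ) :
    (max (a - M) 0 - max (b - M) 0) ^ 2 ≤ (a - b) * (max (a - M) 0 - max (b - M) 0) := by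
  rcases le_total (a - M) 0 with ha | ha <;> rcases le_total (b - M) 0 with hb | hb <;>
    simp only [max_eq_left, max_eq_right, ha, hb] <;> nlinarith

lemma IsWeakSolution.le_barrier (hs0 : 0 < s) (hs1 : s < 1) (hn : 2 ≤ n)
    (hΩ : IsBoundedSmoothDomain Ω) (hA : IsAdmissible s Ω A) {C : ℝ} {φ F g u : Rn n → ℝ}
    (hφ : IsBarrier s Ω A C φ) (hu : IsWeakSolution s Ω A F g u) {M N : ℝ} (hM : 0 ≤ M)
    (hN : 0 ≤ N) (hF : MemLp F ⊤ (volume.restrict Ω)) (hFN : ∀ᵐ x ∂volume.restrict Ω, F x ≤ N)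
    (hgM : ∀ᵐ x ∂volume.restrict (ext Ω), g x ≤ M) :
    ∀ᵐ x, u x ≤ M + N * φ x := by
  have hφs : MemHs s φ := memHs_of_contDiff hs0 hs1 (by omega) hφ.smooth hφ.compact_support
  set w : Rn n → ℝ := u - N • φ with hw
  have hws : MemHs s w := hu.memHs.sub (hφs.const_smul N)
  set f : Rn n → ℝ := fun x => max (w x - M) 0 with hf
  have hfs : MemHs s f := hws.truncate hM
  have hf0 : ∀ x, 0 ≤ f x := fun x => le_max_right _ _
  have hfΩ : f =ᵐ[volume.restrict (ext Ω)] 0 := by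
    filter_upwards [hu.eq_ext, hgM] with x hx hgx
    have : w x ≤ M := by
      simp only [hw, Pi.sub_apply, Pi.smul_apply, smul_eq_mul, hx]
      linarith [mul_nonneg hN (hφ.nonneg x)]
    exact max_eq_right (by linarith)
  have hfi := integrable_of_eq_zero_on_ext hΩ hfs.1 hfΩ
  have hlim := (hΩ.isNonnegTestLimit hs0 hs1 (by omega) hfs hf0 hfΩ).memHsTilde hfs
  have hFf : ∫ x in Ω, F x * f x ≤ N * ∫ x, f x := by
    have h1 : Integrable (fun x => F x * f x) (volume.restrict Ω) :=
      (hfi.mono_measure Measure.restrict_le_self).mul_of_top_right hF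
    have h2 : Integrable (fun x => N * f x) (volume.restrict Ω) :=
      (hfi.mono_measure Measure.restrict_le_self).const_mul N
    calc _ ≤ ∫ x in Ω, N * f x := by
          refine integral_mono_ae h1 h2 ?_
          filter_upwards [hFN] with x hx
          exact mul_le_mul_of_nonneg_right hx (hf0 x)
      _ ≤ ∫ x, N * f x := setIntegral_le_integral (hfi.const_mul N)
          (Filter.Eventually.of_forall fun x => mul_nonneg hN (hf0 x))
      _ = _ := integral_const_mul _ _
  -- The equation contributes at most `N ∫ f`, and `N` times the barrier inequality removes at least
  -- as much.
  have hle : magForm s A w f ≤ 0 := by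
    rw [hw, hA.magForm_sub_smul_left hs0 hs1 hn hu.memHs hφs hfs, hu.eq_in f hlim]
    have := mul_le_mul_of_nonneg_left
      (hφ.integral_le_magForm hs0 hs1 hn hΩ hA hfs hf0 hfΩ) hN
    linarith
  rw [hA.magForm_eq hs0 hs1 hn hws hfs] at hle
  have hβ : 0 ≤ ∫ p, symKernel s A p * ((w p.1 - w p.2) * (f p.1 - f p.2)) :=
    integral_nonneg fun p => mul_nonneg (hA.symKernel_nonneg p)
      ((sq_nonneg _).trans (max_sub_max_sq_le (w p.1) (w p.2) M))
  -- Where `f > 0` one has `w > M ≥ 0`; in the exterior `f = 0`, and the frontier is null.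
  have hq : 0 ≤ ∫ x, potential s A x * (w x * f x) := by
    refine integral_nonneg_of_ae ?_
    filter_upwards [hΩ.ae_mem_or_ext,
      (ae_restrict_iff' isClosed_closure.isOpen_compl.measurableSet).1 hfΩ] with x hx hxe
    rcases hx with hx | hx
    · refine mul_nonneg (hA.potential_nonneg_on hs0 hs1 hn hΩ.isOpen hx) ?_
      rcases le_total (w x - M) 0 with h | h
      · simp only [hf, max_eq_right h, mul_zero, le_refl]
      · exact mul_nonneg (by linarith) (hf0 x)
    · rw [hxe hx]
      simp
  have hws' := memHs_iff.1 hws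
  have hfs' := memHs_iff.1 hfs
  have hG : ∫ p, hsQuot s f p ^ 2 ≤ ∫ p, hsQuot s w p * hsQuot s f p := by
    refine integral_mono hfs'.2.integrable_sq (hws'.2.integrable_mul hfs'.2) fun p => ?_
    simp only [hsQuot, div_pow, div_mul_div_comm, ← pow_two]
    exact div_le_div_of_nonneg_right (max_sub_max_sq_le (w p.1) (w p.2) M) (sq_nonneg _)
  have hG0 : ∫ p, hsQuot s f p ^ 2 = 0 := by
    refine le_antisymm ?_ (integral_nonneg fun _ => sq_nonneg _)
    have hC := fracConst_pos (n := n) hs0 hs1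
    by_contra! h
    nlinarith [mul_pos hC (h.trans_le hG)]
  have hG1 : hsQuot s f =ᵐ[volume] 0 := by
    have h := (integral_eq_zero_iff_of_nonneg (fun _ => sq_nonneg _) hfs'.2.integrable_sq).1 hG0
    filter_upwards [h] with p hp
    simpa using hp
  filter_upwards [ae_eq_zero_of_hsQuot_ae_eq_zero (by omega) hΩ hG1 hfΩ] with x hx
  have h := le_max_left (w x - M) 0
  change max (w x - M) 0 = 0 at hx
  rw [hx] at h
  simp only [hw, Pi.sub_apply, Pi.smul_apply, smul_eq_mul] at h
  linarith

lemma IsWeakSolution.neg {F g u : Rn n → ℝ} (hu : IsWeakSolution s Ω A F g u) :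
    IsWeakSolution s Ω A (-F) (-g) (-u) where
  memHs := by simpa using hu.memHs.const_smul (-1)
  eq_in := fun φ hφ => by
    rw [magForm_neg_left, hu.eq_in φ hφ, ← integral_neg]
    simp
  eq_ext := hu.eq_ext.neg

lemma ae_abs_le_toReal_eLpNorm_top {X : Type*} [MeasurableSpace X] {μ : Measure X} {f : X → ℝ}
    (hf : MemLp f ⊤ μ) : ∀ᵐ x ∂μ, |f x| ≤ (eLpNorm f ⊤ μ).toReal := by
  filter_upwards [ae_le_eLpNormEssSup (f := f) (μ := μ)] with x hx
  rw [← eLpNorm_exponent_top] at hx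
  have := ENNReal.toReal_mono hf.2.ne hx
  rwa [toReal_enorm, Real.norm_eq_abs] at this

/-- The maximum principle in the presence of a barrier. -/
lemma IsWeakSolution.eLpNorm_top_le (hs0 : 0 < s) (hs1 : s < 1) (hn : 2 ≤ n)
    (hΩ : IsBoundedSmoothDomain Ω) (hA : IsAdmissible s Ω A) {C : ℝ} {φ F g u : Rn n → ℝ}
    (hφ : IsBarrier s Ω A C φ) (hF : MemLp F ⊤ (volume.restrict Ω))
    (hg : MemLp g ⊤ (volume.restrict (ext Ω))) (hu : IsWeakSolution s Ω A F g u) :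
    eLpNorm u ⊤ volume ≤ eLpNorm g ⊤ (volume.restrict (ext Ω)) +
      ENNReal.ofReal C * eLpNorm F ⊤ (volume.restrict Ω) := by
  -- `ENNReal.ofReal` would truncate a negative `C`; nonemptiness of `Ω` rules this out.
  have hC : 0 ≤ C := by
    obtain ⟨x, hx⟩ := hΩ.isConnected.nonempty
    exact (hφ.nonneg x).trans (hφ.le_bound x hx)
  have hFN := ae_abs_le_toReal_eLpNorm_top hF
  have hgM := ae_abs_le_toReal_eLpNorm_top hg
  set N := (eLpNorm F ⊤ (volume.restrict Ω)).toReal with hNdef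
  set M := (eLpNorm g ⊤ (volume.restrict (ext Ω))).toReal with hMdef
  have hN : 0 ≤ N := ENNReal.toReal_nonneg
  have hM : 0 ≤ M := ENNReal.toReal_nonneg
  have h1 := hu.le_barrier hs0 hs1 hn hΩ hA hφ hM hN hF
    (hFN.mono fun x hx => (le_abs_self _).trans hx) (hgM.mono fun x hx => (le_abs_self _).trans hx)
  have h2 := hu.neg.le_barrier hs0 hs1 hn hΩ hA hφ hM hN hF.neg
    (hFN.mono fun x hx => (neg_le_abs _).trans hx) (hgM.mono fun x hx => (neg_le_abs _).trans hx)
  -- The barrier is bounded by `C` only in `Ω`, so the exterior is handled by `u = g` directly.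
  have hbound : ∀ᵐ x, ‖u x‖ ≤ M + C * N := by
    have hext : ∀ᵐ x, x ∈ ext Ω → |u x| ≤ M :=
      (ae_restrict_iff' isClosed_closure.isOpen_compl.measurableSet).1
        (by filter_upwards [hu.eq_ext, hgM] with x hx hx'; rwa [hx])
    filter_upwards [h1, h2, hext, hΩ.ae_mem_or_ext] with x hx1 hx2 hx3 hx4
    rw [Real.norm_eq_abs]
    rcases hx4 with hx | hx
    · have hb := mul_le_mul_of_nonneg_left (hφ.le_bound x hx) hN
      rw [Pi.neg_apply] at hx2
      exact abs_le.2 ⟨by linarith, by linarith⟩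
    · exact (hx3 hx).trans (le_add_of_nonneg_right (mul_nonneg hC hN))
  rw [eLpNorm_exponent_top]
  refine (eLpNormEssSup_le_of_ae_bound hbound).trans (le_of_eq ?_)
  rw [ENNReal.ofReal_add hM (mul_nonneg hC hN), ENNReal.ofReal_mul hC, hNdef, hMdef,
    ENNReal.ofReal_toReal hF.2.ne, ENNReal.ofReal_toReal hg.2.ne]

/-! ### A barrier that is independent of the magnetic potential -/

/-- A cutoff `η` equal to `1` on `Ω` attains its maximum there, so its fractional Laplacian on `Ω`
is at least the contribution of jumps to a fixed ball `B` where `η = 0`. Normalizing by this lower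
bound gives the barrier. -/
lemma IsBoundedSmoothDomain.exists_barrier (hs0 : 0 < s) (hs1 : s < 1) (hn : 2 ≤ n)
    (hΩ : IsBoundedSmoothDomain Ω) : ∃ (C : ℝ) (φ : Rn n → ℝ), 0 < C ∧
      ∀ A, IsAdmissible s Ω A → IsBarrier s Ω A C φ := by
  have := nontrivial_Rn (n := n) (by omega)
  obtain ⟨R, hR, hΩR⟩ := hΩ.isBounded.subset_closedBall_lt 0 (0 : Rn n)
  -- The unit ball about `z` lies outside the radius `R + 1` where `η` can be nonzero, and its
  -- points are within `2 R + 4` of those of `Ω`.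
  obtain ⟨z, hz⟩ := exists_norm_eq (Rn n) (c := R + 3) (by positivity)
  let η : ContDiffBump (0 : Rn n) := ⟨R, R + 1, hR, by linarith⟩
  have hη1 : ∀ x ∈ Ω, η x = 1 := fun x hx => η.one_of_mem_closedBall (hΩR hx)
  let B := Metric.ball z 1
  have hη0 : ∀ y ∈ B, η y = 0 := fun y hy => by
    refine η.zero_of_le_dist ?_
    rw [dist_zero_right]
    have h1 := mem_ball_iff_norm'.1 hy
    have h2 := norm_sub_norm_le z y
    change R + 1 ≤ ‖y‖
    linarith
  have hB : 0 < volume.real B :=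
    ENNReal.toReal_pos (Metric.isOpen_ball.measure_pos _ ⟨z, Metric.mem_ball_self one_pos⟩).ne'
      measure_ball_lt_top.ne
  have hC := fracConst_pos (n := n) hs0 hs1
  set δ : ℝ := ((2 * R + 4) ^ ((n : ℝ) / 2 + s))⁻¹ ^ 2 with hδ
  have hδ0 : 0 < δ := by positivity
  set m : ℝ := fracConst n s / 2 * δ * volume.real B with hm
  have hm0 : 0 < m := by positivity
  have hΩ0 : ∀ ψ : Rn n → ℝ, IsTestFunction Ω ψ → ∀ x ∉ Ω, ψ x = 0 := fun ψ hψ x hx =>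
    image_eq_zero_of_notMem_tsupport fun h => hx (hψ.2.2 h)
  have hη : ContDiff ℝ ∞ (fun x => m⁻¹ * η x) := contDiff_const.mul η.contDiff
  refine ⟨m⁻¹, fun x => m⁻¹ * η x, by positivity, fun A hA => ⟨hη, η.hasCompactSupport.mul_left,
    fun ψ hψ hψ0 => ?_, fun x => mul_nonneg (by positivity) η.nonneg, fun x hx => ?_⟩⟩
  · have hφs : MemHs s (fun x => m⁻¹ * η x) :=
      memHs_of_contDiff hs0 hs1 (by omega) hη η.hasCompactSupport.mul_left
    have hψs : MemHs s ψ := memHs_of_contDiff hs0 hs1 (by omega) hψ.1 hψ.2.1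
    have hψi : Integrable ψ := hψ.1.continuous.integrable_of_hasCompactSupport hψ.2.1
    -- The increments of `η` and `ψ` never have opposite signs: `η` is maximal on `Ω`, while `ψ ≥ 0`
    -- vanishes off it.
    have hdiff : ∀ x y, 0 ≤ (m⁻¹ * η x - m⁻¹ * η y) * (ψ x - ψ y) := fun x y => by
      rw [← mul_sub, mul_assoc]
      refine mul_nonneg (by positivity) ?_
      by_cases hx : x ∈ Ω <;> by_cases hy : y ∈ Ω
      · simp [hη1 x hx, hη1 y hy]
      · rw [hη1 x hx, hΩ0 ψ hψ y hy, sub_zero]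
        exact mul_nonneg (sub_nonneg.2 η.le_one) (hψ0 x)
      · rw [hη1 y hy, hΩ0 ψ hψ x hx, zero_sub]
        exact mul_nonneg_of_nonpos_of_nonpos (sub_nonpos.2 η.le_one) (neg_nonpos.2 (hψ0 y))
      · simp [hΩ0 ψ hψ x hx, hΩ0 ψ hψ y hy]
    rw [hA.magForm_eq hs0 hs1 hn hφs hψs]
    have h2 : 0 ≤ ∫ p : Rn n × Rn n, symKernel s A p *
        ((m⁻¹ * η p.1 - m⁻¹ * η p.2) * (ψ p.1 - ψ p.2)) :=
      integral_nonneg fun p => mul_nonneg (hA.symKernel_nonneg p) (hdiff _ _)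
    have h3 : 0 ≤ ∫ x, potential s A x * (m⁻¹ * η x * ψ x) := by
      refine integral_nonneg fun x => ?_
      by_cases hx : x ∈ Ω
      · exact mul_nonneg (hA.potential_nonneg_on hs0 hs1 hn hΩ.isOpen hx)
          (mul_nonneg (mul_nonneg (by positivity) η.nonneg) (hψ0 x))
      · simp [hΩ0 ψ hψ x hx]
    have hi1 : Integrable (fun p : Rn n × Rn n => ψ p.1 * B.indicator (fun _ => (1 : ℝ)) p.2) :=
      hψi.mul_prod ((integrable_indicator_iff measurableSet_ball).2
        (integrableOn_const measure_ball_lt_top.ne))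
    -- Only pairs in `Ω × B` are kept from the nonnegative integrand; there it equals `m⁻¹ ψ x / |x
    -- - y|^{n + 2s}`, and `δ` bounds the weight below.
    have h1 : ∫ p : Rn n × Rn n, m⁻¹ * δ * (ψ p.1 * B.indicator (fun _ => (1 : ℝ)) p.2) ≤
        ∫ p, hsQuot s (fun x => m⁻¹ * η x) p * hsQuot s ψ p := by
      refine integral_mono (hi1.const_mul _)
        ((memHs_iff.1 hφs).2.integrable_mul (memHs_iff.1 hψs).2) fun p => ?_
      have hnn : 0 ≤ hsQuot s (fun x => m⁻¹ * η x) p * hsQuot s ψ p := by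
        simp only [hsQuot, div_mul_div_comm]
        exact div_nonneg (hdiff _ _) (mul_self_nonneg _)
      by_cases hx : p.1 ∈ Ω
      · by_cases hy : p.2 ∈ B
        · have hyΩ : p.2 ∉ Ω := fun h => by
            have := hη0 _ hy
            rw [hη1 _ h] at this
            exact one_ne_zero this
          have hn1 : ‖p.1‖ ≤ R := mem_closedBall_zero_iff.1 (hΩR hx)
          have hn2 : ‖p.2‖ ≤ R + 4 := by
            have h1 := mem_ball_iff_norm.1 hy
            have h2 := norm_sub_norm_le p.2 z
            linarith
          have hd : ‖p.1 - p.2‖ ≤ 2 * R + 4 := (norm_sub_le _ _).trans (by linarith)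
          have hd0 : 0 < ‖p.1 - p.2‖ :=
            norm_pos_iff.2 (sub_ne_zero.2 fun h => hyΩ (h ▸ hx))
          have hinv : ((2 * R + 4) ^ ((n : ℝ) / 2 + s))⁻¹ ≤
              (‖p.1 - p.2‖ ^ ((n : ℝ) / 2 + s))⁻¹ :=
            inv_anti₀ (by positivity) (Real.rpow_le_rpow hd0.le hd (by positivity))
          have hsq := pow_le_pow_left₀ (by positivity) hinv 2
          simp only [hsQuot, hη1 _ hx, hη0 _ hy, hΩ0 ψ hψ _ hyΩ, indicator_of_mem hy]
          calc _ = m⁻¹ * ψ p.1 * δ := by ring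
            _ ≤ m⁻¹ * ψ p.1 * (‖p.1 - p.2‖ ^ ((n : ℝ) / 2 + s))⁻¹ ^ 2 :=
              mul_le_mul_of_nonneg_left hsq (mul_nonneg (by positivity) (hψ0 _))
            _ = _ := by ring
        · simpa [indicator_of_notMem hy] using hnn
      · simpa [hΩ0 ψ hψ _ hx] using hnn
    have h4 : ∫ p : Rn n × Rn n, m⁻¹ * δ * (ψ p.1 * B.indicator (fun _ => (1 : ℝ)) p.2) =
        m⁻¹ * δ * ((∫ x, ψ x) * volume.real B) := by
      have h := integral_prod_mul (μ := (volume : Measure (Rn n))) (ν := (volume : Measure (Rn n)))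
        ψ (B.indicator fun _ => (1 : ℝ))
      rw [integral_indicator_const _ measurableSet_ball, smul_eq_mul, mul_one] at h
      rw [integral_const_mul]
      exact congrArg _ h
    have h5 : fracConst n s / 2 * (m⁻¹ * δ * ((∫ x, ψ x) * volume.real B)) = ∫ x, ψ x := by
      calc _ = m⁻¹ * m * ∫ x, ψ x := by
            rw [hm]
            ring
        _ = _ := by rw [inv_mul_cancel₀ hm0.ne', one_mul]
    have h6 := mul_le_mul_of_nonneg_left (h4 ▸ h1) (by positivity : 0 ≤ fracConst n s / 2)
    linarith
  · rw [hη1 x hx, mul_one]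

end

end FracMagnetic

end

theorem mainTheorem4 (n : ℕ) (hn : 2 ≤ n) (s : ℝ) (hs0 : 0 < s) (hs1 : s < 1)
    (Ω : Set (FracMagnetic.Rn n)) (hΩ : FracMagnetic.IsBoundedSmoothDomain Ω) :
    (∃ C : ℝ, 0 < C ∧
      ∀ A : FracMagnetic.Rn n → FracMagnetic.Rn n → FracMagnetic.Rn n,
        FracMagnetic.IsAdmissible s Ω A →
      ∀ F g u : FracMagnetic.Rn n → ℝ,
        MemLp F ⊤ (volume.restrict Ω) →
        MemLp g ⊤ (volume.restrict (FracMagnetic.ext Ω)) →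
        FracMagnetic.IsWeakSolution s Ω A F g u →
        eLpNorm u ⊤ volume ≤ eLpNorm g ⊤ (volume.restrict (FracMagnetic.ext Ω)) +
          ENNReal.ofReal C * eLpNorm F ⊤ (volume.restrict Ω)) ∧
    (∀ A : FracMagnetic.Rn n → FracMagnetic.Rn n → FracMagnetic.Rn n,
        FracMagnetic.IsAdmissible s Ω A →
      ∀ (C : ℝ) (φ : FracMagnetic.Rn n → ℝ), FracMagnetic.IsBarrier s Ω A C φ →
      ∀ F g u : FracMagnetic.Rn n → ℝ,
        MemLp F ⊤ (volume.restrict Ω) →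
        MemLp g ⊤ (volume.restrict (FracMagnetic.ext Ω)) →
        FracMagnetic.IsWeakSolution s Ω A F g u →
        eLpNorm u ⊤ volume ≤ eLpNorm g ⊤ (volume.restrict (FracMagnetic.ext Ω)) +
          ENNReal.ofReal C * eLpNorm F ⊤ (volume.restrict Ω)) := by
  refine ⟨?_, fun A hA C φ hφ F g u hF hg hu => hu.eLpNorm_top_le hs0 hs1 hn hΩ hA hφ hF hg⟩
  obtain ⟨C, φ, hC, hφ⟩ := hΩ.exists_barrier hs0 hs1 hn
  exact ⟨C, hC, fun A hA F g u hF hg hu => hu.eLpNorm_top_le hs0 hs1 hn hΩ hA (hφ A hA) hF hg⟩
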